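/- Let $H_{\mathbb R}$ be a separable real Hilbert space with complexification $H$ (inner product linear on the right), let $x\mapsto\bar x$ be a self-adjoint ($\mathbb C$-linear) involution of $H$, and let $\alpha,q\in(-1,1)$. Let $\Sigma(n)$ be the hyperoctahedral group of bijections $\sigma$ of $\{\pm1,\dots,\pm n\}$ with $\sigma(-k)=-\sigma(k)$, generated by $\pi_0=(1,-1)$ and $\pi_i=(i,i+1)$, $1\le i\le n-1$, and let $l_1(\sigma)$ (resp. $l_2(\sigma)$) be the number of letters $\pi_0$ (resp. $\pi_i$, $i\ge1$) in a word of minimal length for $\sigma$. The group $\Sigma(n)$ acts on $H^{\otimes n}$: $\pi_i$ exchanges the $i$-th and $(i+1)$-th factors and $\pi_0$ replaces the first factor $x_1$ by $\overline{x_1}$. On the algebraic full Fock space $\mathcal F=\bigoplus_{n\ge0}H^{\otimes n}$ with vacuum $\Omega$ (the unit vector spanning $H^{\otimes 0}$) consider the inner product for which the $H^{\otimes n}$ are orthogonal and $$\langle f,g\rangle_{\alpha,q}=\Big\langle f,\ \sum_{\sigma\in\Sigma(n)}\alpha^{l_1(\sigma)}q^{l_2(\sigma)}\,\sigma g\Big\rangle_{0,0}\quad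 (f,g\in H^{\otimes n}),\qquad \langle x_1\otimes\cdots\otimes x_n,y_1\otimes\cdots\otimes y_n\rangle_{0,0}=\prod_{i=1}^n\langle x_i,y_i\rangle .$$ Let $b^*(x)$ be the operator $x_1\otimes\cdots\otimes x_n\mapsto x_1\otimes\cdots\otimes x_n\otimes x$, $\Omega\mapsto x$, let $b(x)=b^1(x)$ be its adjoint with respect to $\langle\cdot,\cdot\rangle_{\alpha,q}$, and let $G(x)=b(x)+b^*(x)$. Let $\mathcal P_2(n)$ be the set of partitions of $[n]=\{1,\dots,n\}$ all of whose blocks have two elements, and $\mathcal P^B_2(n)$ the set of pairs $(\pi,f)$ with $\pi\in\mathcal P_2(n)$ and $f:\pi\to\{\pm1\}$. For $\epsilon\in\{1,*\}^n$ let $\mathcal P_{2;\epsilon}(n)$ be the set of those $\pi\in\mathcal P_2(n)$ such that $\epsilon(a)=*$ and $\epsilon(b)=1$ for every block $\{a<b\}$ of $\pi$, and $\mathcal P^B_{2;\epsilon}(n)$ the set of $(\pi,f)\in\mathcal P^B_2(n)$ with $\pi\in\mathcal P_{2;\epsilon}(n)$. A block $W$ covers a block $V$ if there are $i,j\in W$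 with $i<k<j$ for all $k\in V$. Let $\mathrm{Cr}(\pi)$ be the number of unordered pairs of crossing blocks ($i<k<j<l$ with $i,j$ in one of them and $k,l$ in the other), $\mathrm{Cov}(V)$ the number of blocks of $\pi$ covering $V$, $\mathrm{NB}(\pi,f)$ the number of blocks with $f=-1$, and $\mathrm{InNB}(\pi,f)$ the number of pairs $(V,W)$ of blocks with $f(V)=-1$ and $W$ covering $V$. Let $n\ge0$ and $x_1,\dots,x_n\in H_{\mathbb R}$ be such that $\langle x_i,\overline{x_j}\rangle=\langle x_j,\overline{x_i}\rangle$ for all $i,j$ (this is automatic if the involution maps $H_{\mathbb R}$ into itself). Then, with empty sums equal to $0$: (1) For every $\epsilon\in\{1,*\}^n$, $$\langle\Omega,b^{\epsilon(n)}(x_n)\cdots b^{\epsilon(1)}(x_1)\Omega\rangle_{\alpha,q}=\sum_{(\pi,f)\in\mathcal P^B_{2;\epsilon}(n)}\alpha^{\mathrm{NB}(\pi,f)}q^{\mathrm{Cr}(\pi)+2\,\mathrm{InNB}(\pi,f)}\prod_{\{i,j\}\in\pi,\,f(\{i,j\})=1}\langle x_i,x_j\rangle\prod_{\{i,j\}\in\pi,\,f(\{i,j\})=-1}\langle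 x_i,\overline{x_j}\rangle$$ $$=\sum_{\pi\in\mathcal P_{2;\epsilon}(n)}q^{\mathrm{Cr}(\pi)}\prod_{\{i,j\}\in\pi}\big(\langle x_i,x_j\rangle+\alpha q^{2\mathrm{Cov}(\{i,j\})}\langle x_i,\overline{x_j}\rangle\big).$$ (2) $$\langle\Omega,G(x_n)\cdots G(x_1)\Omega\rangle_{\alpha,q}=\langle\Omega,G(x_1)\cdots G(x_n)\Omega\rangle_{\alpha,q}$$ $$=\sum_{(\pi,f)\in\mathcal P^B_2(n)}\alpha^{\mathrm{NB}(\pi,f)}q^{\mathrm{Cr}(\pi)+2\,\mathrm{InNB}(\pi,f)}\prod_{\{i,j\}\in\pi,\,f(\{i,j\})=1}\langle x_i,x_j\rangle\prod_{\{i,j\}\in\pi,\,f(\{i,j\})=-1}\langle x_i,\overline{x_j}\rangle$$ $$=\sum_{\pi\in\mathcal P_2(n)}q^{\mathrm{Cr}(\pi)}\prod_{\{i,j\}\in\pi}\big(\langle x_i,x_j\rangle+\alpha q^{2\mathrm{Cov}(\{i,j\})}\langle x_i,\overline{x_j}\rangle\big).$$ -/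

import Mathlib

open scoped TensorProduct DirectSum

noncomputable section

namespace TypeBFock

/-! ## The hyperoctahedral group -/

/-- The `2n` points `±1, …, ±n`: the pair `(k, s)` stands for the signed point `s · (k + 1)`. -/
abbrev SignedPoint (n : ℕ) : Type := Fin n × ℤˣ

/-- The map `k ↦ -k` on the signed points. -/
def negPerm (n : ℕ) : Equiv.Perm (SignedPoint n) where
  toFun p := (p.1, -p.2)
  invFun p := (p.1, -p.2)
  left_inv p := by simp
  right_inv p := by simp

/-- The Coxeter group `Σ(n)` of type B: the bijections `σ` of `{±1, …, ±n}` such that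
`σ(-k) = -σ(k)`, that is, those which commute with `k ↦ -k`. -/
abbrev SigmaB (n : ℕ) : Subgroup (Equiv.Perm (SignedPoint n)) :=
  Subgroup.centralizer {negPerm n}

theorem mem_sigmaB_iff {n : ℕ} (σ : Equiv.Perm (SignedPoint n)) :
    σ ∈ SigmaB n ↔ ∀ p : SignedPoint n, σ (p.1, -p.2) = ((σ p).1, -(σ p).2) := by
  rw [Subgroup.mem_centralizer_singleton_iff]
  constructor
  · intro h p
    exact (Equiv.ext_iff.1 h p : σ (negPerm n p) = negPerm n (σ p))
  · intro h
    ext1 p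
    exact h p

instance instFintypeSigmaB (n : ℕ) : Fintype (SigmaB n) := Fintype.ofFinite _

/-- The generators as permutations of the signed points: `π_0 = (1, -1)` exchanges `1` and `-1`,
and, for `1 ≤ i ≤ n - 1`, `π_i = (i, i + 1)` exchanges `i` with `i + 1` and `-i` with `-(i + 1)`. -/
def genPerm {n : ℕ} (i : Fin n) : Equiv.Perm (SignedPoint n) :=
  if (i : ℕ) = 0 then Equiv.swap (i, 1) (i, -1)
  else Equiv.prodCongr (Equiv.swap ⟨(i : ℕ) - 1, by omega⟩ i) (Equiv.refl ℤˣ)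

theorem genPerm_mem {n : ℕ} (i : Fin n) : genPerm i ∈ SigmaB n := by
  rw [mem_sigmaB_iff]
  rintro ⟨k, s⟩
  unfold genPerm
  split_ifs with h
  · by_cases hk : k = i
    · subst hk
      rcases Int.units_eq_one_or s with rfl | rfl <;> simp
    · rw [Equiv.swap_apply_of_ne_of_ne, Equiv.swap_apply_of_ne_of_ne] <;>
        simp [hk]
  · simp

/-- The generators `π_0, …, π_{n-1}` of `Σ(n)`. -/
def gen {n : ℕ} (i : Fin n) : SigmaB n := ⟨genPerm i, genPerm_mem i⟩

/-- `w` is an irreducible form of `σ`: a word `π_{i_1} ⋯ π_{i_k} = σ` of minimal length. -/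
def IsReducedWord {n : ℕ} (σ : SigmaB n) (w : List (Fin n)) : Prop :=
  (w.map gen).prod = σ ∧ ∀ v : List (Fin n), (v.map gen).prod = σ → w.length ≤ v.length

/-- `l₁(σ)`: the number of letters `π_0` in an irreducible form of `σ`. (All irreducible forms
give the same number, so the infimum is taken over a set with one element.) -/
def l₁ {n : ℕ} (σ : SigmaB n) : ℕ :=
  sInf {k | ∃ w, IsReducedWord σ w ∧ k = w.countP (fun i => decide ((i : ℕ) = 0))}

/-- `l₂(σ)`: the number of letters `π_i`, `1 ≤ i ≤ n - 1`, in an irreducible form of `σ`. (All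
irreducible forms give the same number, so the infimum is over a set with one element.) -/
def l₂ {n : ℕ} (σ : SigmaB n) : ℕ :=
  sInf {k | ∃ w, IsReducedWord σ w ∧ k = w.countP (fun i => decide ((i : ℕ) ≠ 0))}

theorem sigmaB_apply {n : ℕ} (σ : SigmaB n) (k : Fin n) (s : ℤˣ) :
    σ.1 (k, s) = ((σ.1 (k, 1)).1, s * (σ.1 (k, 1)).2) := by
  rcases Int.units_eq_one_or s with rfl | rfl
  · simp
  · have h := (mem_sigmaB_iff σ.1).1 σ.2 (k, 1)
    simpa using h

/-- The sign of `σ(k)`, for `k > 0`. -/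
def sgn {n : ℕ} (σ : SigmaB n) (k : Fin n) : ℤˣ := (σ.1 (k, 1)).2

/-- The permutation `k ↦ |σ(k)|` of `{1, …, n}`. -/
def absPerm {n : ℕ} (σ : SigmaB n) : Equiv.Perm (Fin n) where
  toFun k := (σ.1 (k, 1)).1
  invFun k := ((σ⁻¹).1 (k, 1)).1
  left_inv k := by
    have h := sigmaB_apply σ⁻¹ (σ.1 (k, 1)).1 (σ.1 (k, 1)).2
    have h2 : (σ⁻¹).1 (σ.1 (k, 1)) = (k, 1) := by simp
    rw [Prod.mk.eta, h2] at h
    exact (congrArg Prod.fst h).symm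
  right_inv k := by
    have h := sigmaB_apply σ ((σ⁻¹).1 (k, 1)).1 ((σ⁻¹).1 (k, 1)).2
    have h2 : σ.1 ((σ⁻¹).1 (k, 1)) = (k, 1) := by simp
    rw [Prod.mk.eta, h2] at h
    exact (congrArg Prod.fst h).symm

section Fock

variable {H : Type*} [NormedAddCommGroup H] [InnerProductSpace ℂ H]

/-! ## Real form and tensor powers -/

/-- `HR` is a real Hilbert space and `H` is its complexification: the inner product is real on
the closed real subspace `HR`, and every vector of `H` is `x + i y` with `x, y ∈ HR` (the sum is
then automatically direct). -/
structure IsComplexificationOf (HR : Submodule ℝ H) : Prop where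
  isClosed : IsClosed (HR : Set H)
  inner_im : ∀ x ∈ HR, ∀ y ∈ HR, (inner ℂ x y).im = 0
  exists_add : ∀ z : H, ∃ x ∈ HR, ∃ y ∈ HR, z = x + Complex.I • y

/-- The action of `σ ∈ Σ(n)` on `H^{⊗n}`, with `J` the involution `x ↦ x̄`:
the `|σ(k)|`-th factor of `σ(x_1 ⊗ ⋯ ⊗ x_n)` is `x_k` if `σ(k) > 0`, and `x̄_k` if `σ(k) < 0`. -/
def act (J : H →ₗ[ℂ] H) {n : ℕ} (σ : SigmaB n) : Module.End ℂ (⨂[ℂ]^n H) :=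
  (PiTensorProduct.reindex ℂ (fun _ : Fin n => H) (absPerm σ)).toLinearMap ∘ₗ
    PiTensorProduct.map (fun k => if sgn σ k = 1 then LinearMap.id else J)

theorem act_tprod (J : H →ₗ[ℂ] H) {n : ℕ} (σ : SigmaB n) (x : Fin n → H) :
    act J σ (PiTensorProduct.tprod ℂ x) = PiTensorProduct.tprod ℂ (fun m =>
      if sgn σ ((absPerm σ).symm m) = 1 then x ((absPerm σ).symm m)
      else J (x ((absPerm σ).symm m))) := by
  unfold act
  rw [LinearMap.comp_apply, PiTensorProduct.map_tprod, LinearEquiv.coe_coe,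
    PiTensorProduct.reindex_tprod]
  congr 1
  ext m
  split_ifs <;> rfl

/-- If `J` is an involution, this is a left action of the group `Σ(n)`. -/
theorem act_mul (J : H →ₗ[ℂ] H) (hJ : ∀ x, J (J x) = x) {n : ℕ} (σ τ : SigmaB n) :
    act J (σ * τ) = act J σ * act J τ := by
  have h1 : ∀ k, absPerm (σ * τ) k = absPerm σ (absPerm τ k) := by
    intro k
    change (σ.1 (τ.1 (k, 1))).1 = (σ.1 ((τ.1 (k, 1)).1, 1)).1
    rw [← Prod.mk.eta (p := τ.1 (k, 1)), sigmaB_apply]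
  have h2 : ∀ k, sgn (σ * τ) k = sgn τ k * sgn σ (absPerm τ k) := by
    intro k
    change (σ.1 (τ.1 (k, 1))).2 = (τ.1 (k, 1)).2 * (σ.1 ((τ.1 (k, 1)).1, 1)).2
    conv_lhs => rw [← Prod.mk.eta (p := τ.1 (k, 1)), sigmaB_apply]
  apply PiTensorProduct.ext
  ext x
  simp only [LinearMap.compMultilinearMap_apply, Module.End.mul_apply, act_tprod]
  congr 1
  ext m
  obtain ⟨k, rfl⟩ := (absPerm (σ * τ)).surjective m
  rw [Equiv.symm_apply_apply, h1, Equiv.symm_apply_apply, Equiv.symm_apply_apply, h2]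
  rcases Int.units_eq_one_or (sgn σ (absPerm τ k)) with h | h <;>
    rcases Int.units_eq_one_or (sgn τ k) with h' | h' <;> simp [h, h', hJ]

/-- `π_0(x_1 ⊗ ⋯ ⊗ x_n) = x̄_1 ⊗ x_2 ⊗ ⋯ ⊗ x_n`. -/
theorem act_gen_zero (J : H →ₗ[ℂ] H) {n : ℕ} (i : Fin n) (hi : (i : ℕ) = 0) (x : Fin n → H) :
    act J (gen i) (PiTensorProduct.tprod ℂ x) =
      PiTensorProduct.tprod ℂ (Function.update x i (J (x i))) := by
  have h1 : absPerm (gen i) = Equiv.refl _ := by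
    ext k
    by_cases hk : k = i
    · subst hk; simp [absPerm, gen, genPerm, hi]
    · simp [absPerm, gen, genPerm, hi, Equiv.swap_apply_of_ne_of_ne, hk]
  rw [act_tprod, h1]
  congr 1
  ext k
  by_cases hk : k = i
  · subst hk; simp [sgn, gen, genPerm, hi]
  · simp [sgn, gen, genPerm, hi, Equiv.swap_apply_of_ne_of_ne, hk]

/-- `π_i` exchanges the factors `x_i` and `x_{i+1}` of `x_1 ⊗ ⋯ ⊗ x_n`. -/
theorem act_gen_pos (J : H →ₗ[ℂ] H) {n : ℕ} (i : Fin n) (hi : (i : ℕ) ≠ 0) (x : Fin n → H) :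
    act J (gen i) (PiTensorProduct.tprod ℂ x) =
      PiTensorProduct.tprod ℂ (x ∘ Equiv.swap ⟨(i : ℕ) - 1, by omega⟩ i) := by
  have h1 : absPerm (gen i) = Equiv.swap ⟨(i : ℕ) - 1, by omega⟩ i := by
    ext k
    simp [absPerm, gen, genPerm, hi]
  rw [act_tprod, h1]
  congr 1
  ext k
  simp [sgn, gen, genPerm, hi]

/-- The type B symmetrization operator `P^{(n)} = ∑_{σ ∈ Σ(n)} α^{l₁(σ)} q^{l₂(σ)} σ` on
`H^{⊗n}` (the identity for `n = 0`, as `Σ(0)` is trivial). -/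
def symmetrization (α q : ℝ) (J : H →ₗ[ℂ] H) (n : ℕ) : Module.End ℂ (⨂[ℂ]^n H) :=
  ∑ σ : SigmaB n, ((α : ℂ) ^ l₁ σ * (q : ℂ) ^ l₂ σ) • act J σ

/-- The functional `x_1 ⊗ ⋯ ⊗ x_n ↦ ∏ ⟨y_i, x_i⟩` on `H^{⊗n}`. -/
def tensorInnerLeft {n : ℕ} (y : Fin n → H) : (⨂[ℂ]^n H) →ₗ[ℂ] ℂ :=
  PiTensorProduct.lift
    ((MultilinearMap.mkPiAlgebra ℂ (Fin n) ℂ).compLinearMap (fun i => innerₛₗ ℂ (y i)))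

theorem tensorInnerLeft_tprod {n : ℕ} (y x : Fin n → H) :
    tensorInnerLeft y (PiTensorProduct.tprod ℂ x) = ∏ i, inner ℂ (y i) (x i) := by
  simp [tensorInnerLeft]

theorem tensorInnerLeft_update {n : ℕ} [DecidableEq (Fin n)] (y : Fin n → H) (i : Fin n) (z : H)
    (x : Fin n → H) :
    tensorInnerLeft (Function.update y i z) (PiTensorProduct.tprod ℂ x) =
      inner ℂ z (x i) * ∏ j ∈ Finset.univ.erase i, inner ℂ (y j) (x j) := by
  rw [tensorInnerLeft_tprod, ← Finset.mul_prod_erase _ _ (Finset.mem_univ i)]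
  congr 1
  · simp
  · apply Finset.prod_congr rfl
    intro j hj
    rw [Function.update_of_ne (Finset.ne_of_mem_erase hj)]

/-- The inner product `⟨·,·⟩_{0,0}` of `H^{⊗n}`, as the map `y ↦ (x ↦ ⟨x, y⟩_{0,0})`, linear in
`y` and antilinear in `x`; see `tensorForm_tprod` for its values. -/
def tensorForm (n : ℕ) : (⨂[ℂ]^n H) →ₗ[ℂ] (⨂[ℂ]^n H) →ₗ⋆[ℂ] ℂ :=
  PiTensorProduct.lift
    { toFun := fun y =>
        { toFun := fun t => (starRingEnd ℂ) (tensorInnerLeft y t)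
          map_add' := fun s t => by simp
          map_smul' := fun c t => by simp }
      map_update_add' := by
        intro _ y i a b
        ext t
        induction t using PiTensorProduct.induction_on with
        | smul_tprod r x =>
          simp [tensorInnerLeft_update, add_mul, mul_add]
        | add s t hs ht => rw [map_add, map_add, hs, ht]
      map_update_smul' := by
        intro _ y i c a
        ext t
        induction t using PiTensorProduct.induction_on with
        | smul_tprod r x =>
          simp only [map_smul, LinearMap.coe_mk, AddHom.coe_mk, LinearMap.smul_apply, smul_eq_mul,
            tensorInnerLeft_update, inner_smul_left, map_mul, RingHomCompTriple.comp_apply,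
            RingHom.id_apply]
          ring
        | add s t hs ht => rw [map_add, map_add, hs, ht] }

theorem tensorForm_tprod {n : ℕ} (x y : Fin n → H) :
    tensorForm n (PiTensorProduct.tprod ℂ y) (PiTensorProduct.tprod ℂ x) =
      ∏ i, inner ℂ (x i) (y i) := by
  simp [tensorForm, tensorInnerLeft_tprod]

/-! ## The Fock space of type B -/

variable (H) in
/-- The algebraic full Fock space `⨁_{n ≥ 0} H^{⊗n}`. -/
abbrev Fock : Type _ := ⨁ n : ℕ, ⨂[ℂ]^n H

variable (H) in
/-- The vacuum vector `Ω`, the unit vector spanning `H^{⊗0}` (the empty tensor). -/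
def vacuum : Fock H := DirectSum.lof ℂ ℕ (fun n => ⨂[ℂ]^n H) 0 (PiTensorProduct.tprod ℂ Fin.elim0)

/-- The sesquilinear form `⟨·,·⟩_{α,q}` as the map `g ↦ (f ↦ ⟨f, g⟩_{α,q})`, linear in `g` and
antilinear in `f`. -/
def fockForm (α q : ℝ) (J : H →ₗ[ℂ] H) : Fock H →ₗ[ℂ] Fock H →ₗ⋆[ℂ] ℂ :=
  DirectSum.toModule ℂ ℕ (Fock H →ₗ⋆[ℂ] ℂ) (fun n =>
    (tensorForm n ∘ₗ symmetrization α q J n).compl₂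
      (DirectSum.component ℂ ℕ (fun n => ⨂[ℂ]^n H) n))

/-- The deformed inner product `⟨f, g⟩_{α,q}`: the spaces `H^{⊗n}` are mutually orthogonal, and
`⟨f, g⟩_{α,q} = ⟨f, P^{(n)} g⟩_{0,0}` on `H^{⊗n}`. It is antilinear in `f` and linear in `g`. -/
def fockInner (α q : ℝ) (J : H →ₗ[ℂ] H) (f g : Fock H) : ℂ := fockForm α q J g f

theorem fockInner_lof (α q : ℝ) (J : H →ₗ[ℂ] H) (f : Fock H) (n : ℕ) (t : ⨂[ℂ]^n H) :
    fockInner α q J f (DirectSum.lof ℂ ℕ (fun n => ⨂[ℂ]^n H) n t) =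
      tensorForm n (symmetrization α q J n t) (f n) := by
  simp only [fockInner, fockForm, DirectSum.toModule_lof]
  rfl

/-- The creation operator `b^*(x)` of type B, i.e. the free right creation operator:
`x_1 ⊗ ⋯ ⊗ x_n ↦ x_1 ⊗ ⋯ ⊗ x_n ⊗ x` and `Ω ↦ x`. -/
def creation (x : H) : Module.End ℂ (Fock H) :=
  DirectSum.toModule ℂ ℕ (Fock H) (fun n =>
    DirectSum.lof ℂ ℕ (fun n => ⨂[ℂ]^n H) (n + 1) ∘ₗ
      (PiTensorProduct.lift
        (PiTensorProduct.tprod ℂ (s := fun _ : Fin (n + 1) => H)).curryRight).flip x)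

theorem creation_tprod (x : H) {n : ℕ} (y : Fin n → H) :
    creation x (DirectSum.lof ℂ ℕ (fun n => ⨂[ℂ]^n H) n (PiTensorProduct.tprod ℂ y)) =
      DirectSum.lof ℂ ℕ (fun n => ⨂[ℂ]^n H) (n + 1)
        (PiTensorProduct.tprod ℂ (Fin.snoc y x : Fin (n + 1) → H)) := by
  simp only [creation, DirectSum.toModule_lof, LinearMap.comp_apply, LinearMap.flip_apply,
    PiTensorProduct.lift.tprod, MultilinearMap.curryRight_apply]

/-- `T` is an adjoint of `b^*(x)` with respect to `⟨·,·⟩_{α,q}`. -/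
def IsCreationAdjoint (α q : ℝ) (J : H →ₗ[ℂ] H) (x : H) (T : Module.End ℂ (Fock H)) : Prop :=
  ∀ f g : Fock H, fockInner α q J (creation x f) g = fockInner α q J f (T g)

open Classical in
/-- The annihilation operator `b(x)` of type B: the adjoint of `b^*(x)` with respect to
`⟨·,·⟩_{α,q}`. (For a self-adjoint involution `J` and `α, q ∈ (-1, 1)` it exists and is unique;
the value `0` where there is no adjoint is never used then.) -/
def annihilation (α q : ℝ) (J : H →ₗ[ℂ] H) (x : H) : Module.End ℂ (Fock H) :=
  if h : ∃ T, IsCreationAdjoint α q J x T then h.choose else 0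

/-- The Gaussian operator of type B, `G(x) = b(x) + b^*(x)`. -/
def gaussian (α q : ℝ) (J : H →ₗ[ℂ] H) (x : H) : Module.End ℂ (Fock H) :=
  annihilation α q J x + creation x

/-- The two exponents `1` and `*` in `b^{ε}(x)`. -/
inductive Exponent : Type
  | one
  | star

/-- `b^1(x) = b(x)` and `b^*(x)`. -/
def bOp (α q : ℝ) (J : H →ₗ[ℂ] H) : Exponent → H → Module.End ℂ (Fock H)
  | Exponent.one, x => annihilation α q J x
  | Exponent.star, x => creation x

end Fock

/-! ## Pair partitions of type B -/

/-- The set partitions of `[n]`. -/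
abbrev SetPartition (n : ℕ) : Type := Finpartition (Finset.univ : Finset (Fin n))

/-- The set partitions of `[n]` of type B: a set partition with a colouring of its blocks
by `±1`. -/
abbrev SetPartitionB (n : ℕ) : Type := Σ π : SetPartition n, (π.parts → ℤˣ)

/-- Every block is a pair. -/
def IsPairPartition {n : ℕ} (π : SetPartition n) : Prop := ∀ V ∈ π.parts, V.card = 2

/-- Each pair block `{a, b}` with `a < b` has `ε(a) = *` and `ε(b) = 1`. -/
def IsCompatible {n : ℕ} (ε : Fin n → Exponent) (π : SetPartition n) : Prop :=
  ∀ V ∈ π.parts, ∀ a ∈ V, ∀ b ∈ V, a < b → ε a = Exponent.star ∧ ε b = Exponent.one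

open Classical in
/-- The pair partitions `P_2(n)`; there are none if `n` is odd. -/
def pairPartitions (n : ℕ) : Finset (SetPartition n) :=
  Finset.univ.filter (fun π => IsPairPartition π)

open Classical in
/-- The pair partitions `P_{2;ε}(n)` compatible with `ε`. -/
def pairPartitionsComp {n : ℕ} (ε : Fin n → Exponent) : Finset (SetPartition n) :=
  Finset.univ.filter (fun π => IsPairPartition π ∧ IsCompatible ε π)

open Classical in
/-- The pair partitions `P^B_2(n)` of type B. -/
def pairPartitionsB (n : ℕ) : Finset (SetPartitionB n) :=
  Finset.univ.filter (fun p => IsPairPartition p.1)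

open Classical in
/-- The pair partitions `P^B_{2;ε}(n)` of type B compatible with `ε`. -/
def pairPartitionsBComp {n : ℕ} (ε : Fin n → Exponent) : Finset (SetPartitionB n) :=
  Finset.univ.filter (fun p => IsPairPartition p.1 ∧ IsCompatible ε p.1)

open Classical in
/-- `NB(π, f)`: the number of negative blocks. -/
def NB {n : ℕ} (p : SetPartitionB n) : ℕ :=
  (Finset.univ.filter (fun V : p.1.parts => p.2 V = -1)).card

open Classical in
/-- `Cr(π)`: the number of (unordered) pairs of blocks which cross. -/
def Cr {n : ℕ} (π : SetPartition n) : ℕ :=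
  ((π.parts.powersetCard 2).filter (fun S => ∃ V ∈ S, ∃ W ∈ S, V ≠ W ∧
    ∃ i ∈ V, ∃ j ∈ V, ∃ k ∈ W, ∃ l ∈ W, i < k ∧ k < j ∧ j < l)).card

/-- The block `W` covers the block `V`. -/
def Covers {n : ℕ} (W V : Finset (Fin n)) : Prop :=
  ∃ i ∈ W, ∃ j ∈ W, ∀ k ∈ V, i < k ∧ k < j

open Classical in
/-- `Cov(V)`: the number of blocks of `π` which cover `V`. -/
def Cov {n : ℕ} (π : SetPartition n) (V : Finset (Fin n)) : ℕ :=
  (π.parts.filter (fun W => Covers W V)).card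

open Classical in
/-- `InNB(π, f)`: the number of pairs `(V, W)` of a negative pair block and a block covering it. -/
def InNB {n : ℕ} (p : SetPartitionB n) : ℕ :=
  (Finset.univ.filter (fun VW : p.1.parts × p.1.parts =>
    VW.1.1.card = 2 ∧ p.2 VW.1 = -1 ∧ Covers VW.2.1 VW.1.1)).card

/-- For a pair block `V = {i, j}` with `i < j`, this is `c i j`. -/
def onPair {n : ℕ} (c : Fin n → Fin n → ℂ) (V : Finset (Fin n)) : ℂ :=
  ∏ ij ∈ (V ×ˢ V).filter (fun ij => ij.1 < ij.2), c ij.1 ij.2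

theorem onPair_pair {n : ℕ} (c : Fin n → Fin n → ℂ) {i j : Fin n} (h : i < j) :
    onPair c {i, j} = c i j := by
  have : (({i, j} : Finset (Fin n)) ×ˢ {i, j}).filter (fun ij => ij.1 < ij.2) = {(i, j)} := by
    ext ⟨a, b⟩
    simp only [Finset.mem_filter, Finset.mem_product, Finset.mem_insert, Finset.mem_singleton,
      Prod.mk.injEq]
    constructor
    · rintro ⟨⟨rfl | rfl, rfl | rfl⟩, hab⟩ <;> simp_all [lt_asymm h]
    · rintro ⟨rfl, rfl⟩
      exact ⟨⟨Or.inl rfl, Or.inr rfl⟩, h⟩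
  rw [onPair, this, Finset.prod_singleton]

section Weights

variable {H : Type*} [NormedAddCommGroup H] [InnerProductSpace ℂ H]

open Classical in
/-- The weight `α^{NB(π,f)} q^{Cr(π) + 2 InNB(π,f)}
∏_{{i,j} ∈ π, f = 1} ⟨x_i, x_j⟩ ∏_{{i,j} ∈ π, f = -1} ⟨x_i, x̄_j⟩` of a pair partition `(π, f)`
of type B. -/
def weightB (α q : ℝ) (J : H →ₗ[ℂ] H) {n : ℕ} (x : Fin n → H) (p : SetPartitionB n) : ℂ :=
  (α : ℂ) ^ NB p * (q : ℂ) ^ (Cr p.1 + 2 * InNB p) *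
    (∏ V ∈ Finset.univ.filter (fun V : p.1.parts => p.2 V = 1),
      onPair (fun i j => inner ℂ (x i) (x j)) V.1) *
    ∏ V ∈ Finset.univ.filter (fun V : p.1.parts => p.2 V = -1),
      onPair (fun i j => inner ℂ (x i) (J (x j))) V.1

/-- The weight `q^{Cr(π)} ∏_{{i,j} ∈ π} (⟨x_i, x_j⟩ + α q^{2 Cov({i,j})} ⟨x_i, x̄_j⟩)` of a pair
partition `π`. -/
def weight (α q : ℝ) (J : H →ₗ[ℂ] H) {n : ℕ} (x : Fin n → H) (π : SetPartition n) : ℂ :=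
  (q : ℂ) ^ Cr π * ∏ V ∈ π.parts,
    onPair (fun i j => inner ℂ (x i) (x j) +
      (α : ℂ) * (q : ℂ) ^ (2 * Cov π V) * inner ℂ (x i) (J (x j))) V

end Weights

end TypeBFock

end

/-!
`b(x)` acts on elementary tensors by an explicit contraction: every element of `Σ(n + 1)` is
uniquely an element of `Σ(n)` times a coset representative, and the two lengths add up along this
factorization, so that the symmetrization of degree `n + 1` factors through the one of degree `n`.
A word in the `b^*(x_i)` and `b(x_i)` then builds pairings by processing the points from left to
right. Creation opens a point, and contraction closes the `k`-th of the open points: the new pair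
crosses the pairs of the later open points, which accounts for `q^{Cr}`, and is covered by the pairs
of the earlier ones, which accounts for `q^{2 Cov}`.

The form may be degenerate, so an adjoint of `b^*(x)` need not be unique; but the matrix elements of
a word only depend on adjoints of its letters, so each letter may be replaced by the explicit one.
Reversing a word in the self-adjoint operators `G(x_i)` conjugates its vacuum expectation, and the
weights of the pair partitions are real.
-/

namespace TypeBFock

/-! ### Lengths in the hyperoctahedral group -/

section SignedPermutations

variable {n : ℕ}

theorem sigmaB_ext {σ τ : SigmaB n} (habs : ∀ k, absPerm σ k = absPerm τ k)
    (hsgn : ∀ k, sgn σ k = sgn τ k) : σ = τ := by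
  apply Subtype.ext
  ext1 ⟨k, s⟩
  rw [sigmaB_apply, sigmaB_apply τ]
  exact Prod.ext (habs k) (congrArg (s * ·) (hsgn k))

theorem absPerm_mul (σ τ : SigmaB n) (k : Fin n) :
    absPerm (σ * τ) k = absPerm σ (absPerm τ k) := by
  change (σ.1 (τ.1 (k, 1))).1 = (σ.1 ((τ.1 (k, 1)).1, 1)).1
  rw [← Prod.mk.eta (p := τ.1 (k, 1)), sigmaB_apply]

theorem sgn_mul (σ τ : SigmaB n) (k : Fin n) :
    sgn (σ * τ) k = sgn τ k * sgn σ (absPerm τ k) := by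
  change (σ.1 (τ.1 (k, 1))).2 = (τ.1 (k, 1)).2 * (σ.1 ((τ.1 (k, 1)).1, 1)).2
  conv_lhs => rw [← Prod.mk.eta (p := τ.1 (k, 1)), sigmaB_apply]

@[simp] theorem absPerm_one (k : Fin n) : absPerm (1 : SigmaB n) k = k := rfl

@[simp] theorem sgn_one (k : Fin n) : sgn (1 : SigmaB n) k = 1 := rfl

theorem absPerm_inv_apply (σ : SigmaB n) (k : Fin n) : absPerm σ⁻¹ (absPerm σ k) = k := by
  rw [← absPerm_mul, inv_mul_cancel, absPerm_one]

theorem sgn_inv_apply (σ : SigmaB n) (k : Fin n) : sgn σ⁻¹ (absPerm σ k) = sgn σ k := by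
  have h : sgn σ k * sgn σ⁻¹ (absPerm σ k) = 1 := by rw [← sgn_mul, inv_mul_cancel, sgn_one]
  rw [eq_inv_of_mul_eq_one_right h, Int.units_inv_eq_self]

/-- The signed permutation `k ↦ s(k) · p(k)`. -/
def ofPermSign (p : Equiv.Perm (Fin n)) (s : Fin n → ℤˣ) : SigmaB n :=
  ⟨{ toFun := fun a => (p a.1, a.2 * s a.1)
     invFun := fun a => (p.symm a.1, a.2 * s (p.symm a.1))
     left_inv := fun a => by simp [mul_assoc]
     right_inv := fun a => by simp [mul_assoc] },
   (mem_sigmaB_iff _).2 fun a => by simp⟩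

@[simp] theorem absPerm_ofPermSign (p : Equiv.Perm (Fin n)) (s : Fin n → ℤˣ) :
    absPerm (ofPermSign p s) = p := rfl

@[simp] theorem sgn_ofPermSign (p : Equiv.Perm (Fin n)) (s : Fin n → ℤˣ) (k : Fin n) :
    sgn (ofPermSign p s) k = s k := by
  simp [sgn, ofPermSign]

/-- A signed permutation is a permutation with a choice of signs. -/
def sigmaEquiv (n : ℕ) : SigmaB n ≃ Equiv.Perm (Fin n) × (Fin n → ℤˣ) where
  toFun σ := (absPerm σ, sgn σ)
  invFun a := ofPermSign a.1 a.2
  left_inv σ := sigmaB_ext (by simp) (by simp)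
  right_inv a := Prod.ext (by simp) (by ext; simp)

theorem card_sigmaB (n : ℕ) : Fintype.card (SigmaB n) = n.factorial * 2 ^ n := by
  rw [Fintype.card_congr (sigmaEquiv n)]
  simp [Fintype.card_perm]

theorem exists_covBy_of_ne_zero {i : Fin n} (hi : (i : ℕ) ≠ 0) : ∃ a : Fin n, a ⋖ i :=
  ⟨⟨i - 1, by omega⟩, Fin.covBy_iff.2 (Nat.covBy_iff_add_one_eq.2 (Nat.sub_one_add_one hi))⟩

theorem val_ne_zero_of_covBy {a i : Fin n} (h : a ⋖ i) : (i : ℕ) ≠ 0 :=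
  Nat.ne_zero_of_lt h.lt

@[simp] theorem absPerm_gen_of_eq_zero {i : Fin n} (hi : (i : ℕ) = 0) (k : Fin n) :
    absPerm (gen i) k = k := by
  obtain rfl | hk := eq_or_ne k i
  · simp [absPerm, gen, genPerm, hi]
  · simp [absPerm, gen, genPerm, hi, Equiv.swap_apply_of_ne_of_ne, hk]

theorem sgn_gen_of_eq_zero {i : Fin n} (hi : (i : ℕ) = 0) (k : Fin n) :
    sgn (gen i) k = if k = i then -1 else 1 := by
  obtain rfl | hk := eq_or_ne k i
  · simp [sgn, gen, genPerm, hi]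
  · simp [sgn, gen, genPerm, hi, Equiv.swap_apply_of_ne_of_ne, hk]

theorem absPerm_gen_of_covBy {a i : Fin n} (h : a ⋖ i) (k : Fin n) :
    absPerm (gen i) k = Equiv.swap a i k := by
  have ha : a = ⟨(i : ℕ) - 1, by omega⟩ :=
    Fin.ext (Nat.eq_sub_of_add_eq (Nat.covBy_iff_add_one_eq.1 (Fin.covBy_iff.1 h)))
  simp [absPerm, gen, genPerm, val_ne_zero_of_covBy h, ha]

theorem sgn_gen_of_ne_zero {i : Fin n} (hi : (i : ℕ) ≠ 0) (k : Fin n) : sgn (gen i) k = 1 := by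
  simp [sgn, gen, genPerm, hi]

theorem gen_mul_self (i : Fin n) : gen i * gen i = 1 := by
  by_cases hi : (i : ℕ) = 0
  · refine sigmaB_ext (fun k => ?_) fun k => ?_
    · simp [absPerm_mul, hi]
    · by_cases hk : k = i <;> simp [sgn_mul, hi, sgn_gen_of_eq_zero, hk]
  · obtain ⟨a, ha⟩ := exists_covBy_of_ne_zero hi
    refine sigmaB_ext (fun k => ?_) fun k => ?_
    · simp [absPerm_mul, absPerm_gen_of_covBy ha]
    · simp [sgn_mul, sgn_gen_of_ne_zero hi]

/-- The number of `k > 0` with `σ(k) < 0`; it equals `l₁ σ`. -/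
def negCount (σ : SigmaB n) : ℕ := ∑ k, if sgn σ k = -1 then 1 else 0

/-- The number of type B inversions contributed by the pair of positions `i < j`: one for
`|σ(j)| < |σ(i)|`, and otherwise two if `σ(j) < 0`. -/
def invWeight (σ : SigmaB n) (i j : Fin n) : ℕ :=
  if absPerm σ j < absPerm σ i then 1 else if sgn σ j = -1 then 2 else 0

/-- The number of type B inversions other than those counted by `negCount`; it equals `l₂ σ`. -/
def invCount (σ : SigmaB n) : ℕ :=
  ∑ p : Fin n × Fin n with p.1 < p.2, invWeight σ p.1 p.2

theorem negCount_mul_gen_add_one {σ : SigmaB n} {i : Fin n} (hi : (i : ℕ) = 0)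
    (h : sgn σ i = -1) : negCount (σ * gen i) + 1 = negCount σ := by
  simp only [negCount, sgn_mul, sgn_gen_of_eq_zero hi, absPerm_gen_of_eq_zero hi]
  rw [← Finset.add_sum_erase _ _ (Finset.mem_univ i),
    ← Finset.add_sum_erase _ (fun k => if sgn σ k = -1 then 1 else 0) (Finset.mem_univ i)]
  have hrest : ∀ k ∈ Finset.univ.erase i,
      (if (if k = i then -1 else 1) * sgn σ k = -1 then 1 else 0) =
        if sgn σ k = -1 then 1 else 0 :=
    fun k hk => by rw [if_neg (Finset.ne_of_mem_erase hk), one_mul]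
  rw [Finset.sum_congr rfl hrest]
  simp [h, add_comm]

theorem negCount_mul_gen_le (σ : SigmaB n) {i : Fin n} (hi : (i : ℕ) = 0) :
    negCount (σ * gen i) ≤ negCount σ + 1 := by
  obtain h | h := Int.units_eq_one_or (sgn σ i)
  · have hdescent := negCount_mul_gen_add_one (σ := σ * gen i) hi
      (by simp [sgn_mul, sgn_gen_of_eq_zero hi, hi, h])
    rw [mul_assoc, gen_mul_self, mul_one] at hdescent
    exact hdescent.ge
  · have := negCount_mul_gen_add_one hi h
    omega

theorem negCount_mul_gen_of_ne_zero (σ : SigmaB n) {i : Fin n} (hi : (i : ℕ) ≠ 0) :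
    negCount (σ * gen i) = negCount σ := by
  simp only [negCount, sgn_mul, sgn_gen_of_ne_zero hi, one_mul]
  exact Equiv.sum_comp (absPerm (gen i)) (fun k => if sgn σ k = -1 then 1 else 0)

theorem invCount_mul_gen_of_eq_zero (σ : SigmaB n) {i : Fin n} (hi : (i : ℕ) = 0) :
    invCount (σ * gen i) = invCount σ := by
  refine Finset.sum_congr rfl fun p hp => ?_
  have hne : p.2 ≠ i := fun h =>
    Nat.not_lt_zero p.1 (hi ▸ h ▸ Fin.lt_def.1 (Finset.mem_filter.1 hp).2)
  simp [invWeight, absPerm_mul, sgn_mul, sgn_gen_of_eq_zero hi, hi, hne]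

theorem swap_lt_swap_of_covBy {α : Type*} [LinearOrder α] {a b x y : α} (hab : a ⋖ b)
    (hxy : x < y) (hne : (x, y) ≠ (a, b)) : Equiv.swap a b x < Equiv.swap a b y := by
  have hbetween : ∀ z, ¬ (a < z ∧ z < b) := fun z hz => hab.2 hz.1 hz.2
  have := hab.lt
  simp only [Equiv.swap_apply_def]
  grind

theorem sum_lt_swap_of_covBy {α M : Type*} [Fintype α] [LinearOrder α] [AddCommMonoid M]
    {a b : α} (hab : a ⋖ b) (F : α → α → M) :
    (∑ p : α × α with p.1 < p.2, F (Equiv.swap a b p.1) (Equiv.swap a b p.2)) + F a b =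
      (∑ p : α × α with p.1 < p.2, F p.1 p.2) + F b a := by
  have hmem : (a, b) ∈ Finset.univ.filter fun p : α × α => p.1 < p.2 := by simp [hab.lt]
  have hrest : ∑ p ∈ (Finset.univ.filter fun p : α × α => p.1 < p.2).erase (a, b),
      F (Equiv.swap a b p.1) (Equiv.swap a b p.2) =
        ∑ p ∈ (Finset.univ.filter fun p : α × α => p.1 < p.2).erase (a, b), F p.1 p.2 := by
    have hswap : ∀ p ∈ (Finset.univ.filter fun p : α × α => p.1 < p.2).erase (a, b),
        (Equiv.swap a b p.1, Equiv.swap a b p.2) ∈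
          (Finset.univ.filter fun p : α × α => p.1 < p.2).erase (a, b) := by
      simp only [Finset.mem_erase, Finset.mem_filter_univ]
      rintro ⟨x, y⟩ ⟨hne, hxy⟩
      refine ⟨fun h => ?_, swap_lt_swap_of_covBy hab hxy hne⟩
      obtain ⟨hx, hy⟩ := Prod.mk.inj h
      rw [Equiv.swap_apply_eq_iff] at hx hy
      simp only [Equiv.swap_apply_left, Equiv.swap_apply_right] at hx hy
      exact hab.lt.not_gt (hx ▸ hy ▸ hxy)
    refine Finset.sum_nbij' (fun p => (Equiv.swap a b p.1, Equiv.swap a b p.2))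
      (fun p => (Equiv.swap a b p.1, Equiv.swap a b p.2)) hswap hswap ?_ ?_ ?_ <;> simp
  rw [← Finset.add_sum_erase _ _ hmem, ← Finset.add_sum_erase _ (fun p => F p.1 p.2) hmem, hrest,
    Equiv.swap_apply_left, Equiv.swap_apply_right]
  abel

theorem invCount_mul_gen_of_covBy (σ : SigmaB n) {a i : Fin n} (h : a ⋖ i) :
    invCount (σ * gen i) + invWeight σ a i = invCount σ + invWeight σ i a := by
  rw [invCount, invCount, ← sum_lt_swap_of_covBy h (invWeight σ)]
  simp [invWeight, absPerm_mul, sgn_mul, absPerm_gen_of_covBy h,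
    sgn_gen_of_ne_zero (val_ne_zero_of_covBy h)]

theorem invWeight_swap_le (σ : SigmaB n) {i j : Fin n} (h : i ≠ j) :
    invWeight σ i j ≤ invWeight σ j i + 1 := by
  have hne : absPerm σ i ≠ absPerm σ j := (absPerm σ).injective.ne h
  unfold invWeight
  grind

theorem invCount_mul_gen_le (σ : SigmaB n) {a i : Fin n} (h : a ⋖ i) :
    invCount (σ * gen i) ≤ invCount σ + 1 := by
  have hmul := invCount_mul_gen_of_covBy σ h
  have hswap := invWeight_swap_le σ h.ne'
  omega

@[simp] theorem negCount_one : negCount (1 : SigmaB n) = 0 := by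
  simp [negCount]

@[simp] theorem invCount_one : invCount (1 : SigmaB n) = 0 := by
  refine Finset.sum_eq_zero fun p hp => ?_
  simp [invWeight, (Finset.mem_filter.1 hp).2.le]

/-- The number of letters `π_0` in a word in the generators. -/
def zeroLetters (w : List (Fin n)) : ℕ := w.countP fun i : Fin n => (i : ℕ) = 0

/-- The number of letters `π_i`, `i ≥ 1`, in a word in the generators. -/
def posLetters (w : List (Fin n)) : ℕ := w.countP fun i : Fin n => (i : ℕ) ≠ 0

theorem length_eq_zeroLetters_add_posLetters (w : List (Fin n)) :
    w.length = zeroLetters w + posLetters w := by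
  rw [List.length_eq_countP_add_countP (fun i : Fin n => (i : ℕ) = 0)]
  simp [zeroLetters, posLetters]

theorem negCount_prod_le (w : List (Fin n)) : negCount (w.map gen).prod ≤ zeroLetters w := by
  induction w using List.reverseRecOn with
  | nil => simp
  | append_singleton w i ih =>
    simp only [zeroLetters, List.map_append, List.prod_append, List.map_singleton,
      List.prod_singleton, List.countP_append, List.countP_singleton] at ih ⊢
    by_cases hi : (i : ℕ) = 0
    · simpa [hi] using (negCount_mul_gen_le _ hi).trans (Nat.add_le_add_right ih 1)
    · simpa [hi, negCount_mul_gen_of_ne_zero] using ih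

theorem invCount_prod_le (w : List (Fin n)) : invCount (w.map gen).prod ≤ posLetters w := by
  induction w using List.reverseRecOn with
  | nil => simp
  | append_singleton w i ih =>
    simp only [posLetters, List.map_append, List.prod_append, List.map_singleton,
      List.prod_singleton, List.countP_append, List.countP_singleton] at ih ⊢
    by_cases hi : (i : ℕ) = 0
    · simpa [hi, invCount_mul_gen_of_eq_zero] using ih
    · obtain ⟨a, ha⟩ := exists_covBy_of_ne_zero hi
      simpa [hi] using (invCount_mul_gen_le _ ha).trans (Nat.add_le_add_right ih 1)

theorem pos_of_not_descent {σ : SigmaB n} {a i : Fin n} (hai : a ≠ i)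
    (h : invWeight σ a i ≤ invWeight σ i a) (ha : sgn σ a = 1) :
    sgn σ i = 1 ∧ absPerm σ a < absPerm σ i := by
  have hne : absPerm σ a ≠ absPerm σ i := (absPerm σ).injective.ne hai
  have hsgn : (1 : ℤˣ) ≠ -1 := by decide
  have := Int.units_eq_one_or (sgn σ i)
  unfold invWeight at h
  grind

theorem eq_one_of_no_descent {σ : SigmaB n} (hzero : ∀ i : Fin n, (i : ℕ) = 0 → sgn σ i = 1)
    (hcov : ∀ a i : Fin n, a ⋖ i → invWeight σ a i ≤ invWeight σ i a) : σ = 1 := by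
  have hsgn : ∀ k : Fin n, sgn σ k = 1 := by
    intro k
    induction k using WellFoundedLT.induction with
    | _ k ih =>
      by_cases hk : (k : ℕ) = 0
      · exact hzero k hk
      · obtain ⟨a, ha⟩ := exists_covBy_of_ne_zero hk
        exact (pos_of_not_descent ha.ne (hcov a k ha) (ih a ha.lt)).1
  have hmono : StrictMono (absPerm σ) := (strictMono_iff_forall_covBy _).2 fun a i h =>
    (pos_of_not_descent h.ne (hcov a i h) (hsgn a)).2
  have hid : ⇑(absPerm σ) = id :=
    (hmono.range_inj strictMono_id).1 (by simp [(absPerm σ).surjective.range_eq])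
  exact sigmaB_ext (congrFun hid) hsgn

theorem exists_word (σ : SigmaB n) : ∃ w : List (Fin n), (w.map gen).prod = σ ∧
    zeroLetters w = negCount σ ∧ posLetters w = invCount σ := by
  induction hN : negCount σ + invCount σ using Nat.strong_induction_on generalizing σ with
  | _ N ih =>
  by_cases hzero : ∀ i : Fin n, (i : ℕ) = 0 → sgn σ i = 1
  · by_cases hcov : ∀ a i : Fin n, a ⋖ i → invWeight σ a i ≤ invWeight σ i a
    · exact ⟨[], by simp [eq_one_of_no_descent hzero hcov, zeroLetters, posLetters]⟩
    push Not at hcov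
    obtain ⟨a, i, hai, hlt⟩ := hcov
    have hi := val_ne_zero_of_covBy hai
    have hneg := negCount_mul_gen_of_ne_zero σ hi
    have hinv : invCount (σ * gen i) + 1 = invCount σ := by
      have hmul := invCount_mul_gen_of_covBy σ hai
      have hswap := invWeight_swap_le σ hai.ne
      omega
    obtain ⟨w, hw, hw₁, hw₂⟩ := ih _ (by omega) (σ * gen i) rfl
    refine ⟨w ++ [i], by simp [hw, mul_assoc, gen_mul_self], ?_, ?_⟩
    · rw [← hneg, ← hw₁]; simp [zeroLetters, hi]
    · rw [← hinv, ← hw₂]; simp [posLetters, hi]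
  · push Not at hzero
    obtain ⟨i, hi, hs⟩ := hzero
    have hneg := negCount_mul_gen_add_one hi ((Int.units_eq_one_or _).resolve_left hs)
    have hinv := invCount_mul_gen_of_eq_zero σ hi
    obtain ⟨w, hw, hw₁, hw₂⟩ := ih _ (by omega) (σ * gen i) rfl
    refine ⟨w ++ [i], by simp [hw, mul_assoc, gen_mul_self], ?_, ?_⟩
    · rw [← hneg, ← hw₁]; simp [zeroLetters, hi]
    · rw [← hinv, ← hw₂]; simp [posLetters, hi]

theorem IsReducedWord.letters_eq {σ : SigmaB n} {w : List (Fin n)} (h : IsReducedWord σ w) :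
    zeroLetters w = negCount σ ∧ posLetters w = invCount σ := by
  obtain ⟨v, hv, hv₁, hv₂⟩ := exists_word σ
  have hlen := h.2 v hv
  have hneg := negCount_prod_le w
  have hinv := invCount_prod_le w
  rw [length_eq_zeroLetters_add_posLetters, length_eq_zeroLetters_add_posLetters] at hlen
  rw [h.1] at hneg hinv
  omega

theorem exists_isReducedWord (σ : SigmaB n) : ∃ w, IsReducedWord σ w := by
  obtain ⟨v, hv, -⟩ := exists_word σ
  obtain ⟨w, hw, hmin⟩ := exists_minimalFor_of_wellFoundedLT
    (fun w : List (Fin n) => (w.map gen).prod = σ) List.length ⟨v, hv⟩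
  exact ⟨w, hw, fun u hu => (le_total _ _).elim id (hmin hu)⟩

theorem sInf_isReducedWord {σ : SigmaB n} {f : List (Fin n) → ℕ} {c : ℕ}
    (h : ∀ w, IsReducedWord σ w → f w = c) :
    sInf {k | ∃ w, IsReducedWord σ w ∧ k = f w} = c := by
  obtain ⟨w, hw⟩ := exists_isReducedWord σ
  have hset : {k | ∃ w, IsReducedWord σ w ∧ k = f w} = {c} :=
    Set.eq_singleton_iff_unique_mem.2
      ⟨⟨w, hw, (h w hw).symm⟩, fun _ ⟨u, hu, hk⟩ => hk.trans (h u hu)⟩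
  rw [hset, csInf_singleton]

-- In `l₁` and `l₂` the letters are counted after a coercion of the word to `List ℕ`.
theorem countP_coe (w : List (Fin n)) (p : ℕ → Bool) :
    (do let a ← w; pure (a : ℕ) : List ℕ).countP p = w.countP fun i : Fin n => p i := by
  rw [bind_pure_comp]
  exact List.countP_map ..

theorem l₁_eq_negCount (σ : SigmaB n) : l₁ σ = negCount σ :=
  sInf_isReducedWord fun w hw => (countP_coe w _).trans hw.letters_eq.1

theorem l₂_eq_invCount (σ : SigmaB n) : l₂ σ = invCount σ :=
  sInf_isReducedWord fun w hw => (countP_coe w _).trans hw.letters_eq.2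

theorem prod_map_gen_reverse (w : List (Fin n)) :
    (w.reverse.map gen).prod = (w.map gen).prod⁻¹ := by
  simp [List.prod_inv_reverse, Function.comp_def,
    fun i : Fin n => inv_eq_of_mul_eq_one_left (gen_mul_self i)]

theorem IsReducedWord.reverse {σ : SigmaB n} {w : List (Fin n)} (h : IsReducedWord σ w) :
    IsReducedWord σ⁻¹ w.reverse := by
  refine ⟨by rw [prod_map_gen_reverse, h.1], fun v hv => ?_⟩
  rw [List.length_reverse, ← List.length_reverse (as := v)]
  exact h.2 _ (by rw [prod_map_gen_reverse, hv, inv_inv])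

theorem negCount_inv (σ : SigmaB n) : negCount σ⁻¹ = negCount σ := by
  obtain ⟨w, hw⟩ := exists_isReducedWord σ
  rw [← hw.letters_eq.1, ← hw.reverse.letters_eq.1, zeroLetters, List.countP_reverse, zeroLetters]

theorem invCount_inv (σ : SigmaB n) : invCount σ⁻¹ = invCount σ := by
  obtain ⟨w, hw⟩ := exists_isReducedWord σ
  rw [← hw.letters_eq.2, ← hw.reverse.letters_eq.2, posLetters, List.countP_reverse, posLetters]

/-- The permutation of `Fin (n + 1)` which maps `k` to the last point and is `p` elsewhere. -/
def extendPerm (k : Fin (n + 1)) (p : Equiv.Perm (Fin n)) : Equiv.Perm (Fin (n + 1)) :=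
  (finSuccEquiv' k).trans ((Equiv.optionCongr p).trans (finSuccEquiv' (Fin.last n)).symm)

/-- The signed permutation which maps `k` to `s` times the last point and is `τ` elsewhere. These
elements, for varying `(k, s)`, form the cosets of `Σ(n)` in `Σ(n + 1)`. -/
def extend (k : Fin (n + 1)) (s : ℤˣ) (τ : SigmaB n) : SigmaB (n + 1) :=
  ofPermSign (extendPerm k (absPerm τ)) (k.insertNth (α := fun _ => ℤˣ) s (sgn τ))

@[simp] theorem absPerm_extend_self (k : Fin (n + 1)) (s : ℤˣ) (τ : SigmaB n) :
    absPerm (extend k s τ) k = Fin.last n := by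
  simp [extend, extendPerm]

@[simp] theorem absPerm_extend_succAbove (k : Fin (n + 1)) (s : ℤˣ) (τ : SigmaB n) (j : Fin n) :
    absPerm (extend k s τ) (k.succAbove j) = (absPerm τ j).castSucc := by
  simp [extend, extendPerm]

@[simp] theorem sgn_extend_self (k : Fin (n + 1)) (s : ℤˣ) (τ : SigmaB n) :
    sgn (extend k s τ) k = s := by
  simp [extend]

@[simp] theorem sgn_extend_succAbove (k : Fin (n + 1)) (s : ℤˣ) (τ : SigmaB n) (j : Fin n) :
    sgn (extend k s τ) (k.succAbove j) = sgn τ j := by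
  simp [extend]

theorem extend_injective (n : ℕ) :
    Function.Injective fun a : Fin (n + 1) × ℤˣ × SigmaB n => extend a.1 a.2.1 a.2.2 := by
  rintro ⟨k, s, τ⟩ ⟨k', s', τ'⟩ (h : extend k s τ = extend k' s' τ')
  obtain rfl : k = k' := (absPerm (extend k s τ)).injective <| by
    rw [absPerm_extend_self, h, absPerm_extend_self]
  obtain rfl : s = s' := by simpa using congrArg (sgn · k) h
  obtain rfl : τ = τ' := sigmaB_ext
    (fun j => by simpa using congrArg (fun ρ => absPerm ρ (k.succAbove j)) h)
    (fun j => by simpa using congrArg (fun ρ => sgn ρ (k.succAbove j)) h)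
  rfl

theorem extend_bijective (n : ℕ) :
    Function.Bijective fun a : Fin (n + 1) × ℤˣ × SigmaB n => extend a.1 a.2.1 a.2.2 := by
  rw [Fintype.bijective_iff_injective_and_card]
  refine ⟨extend_injective n, ?_⟩
  rw [Fintype.card_prod, Fintype.card_prod, card_sigmaB, card_sigmaB, Fintype.card_fin,
    Fintype.card_units_int, Nat.factorial_succ, pow_succ]
  ring

theorem sum_sigmaB_succ {M : Type*} [AddCommMonoid M] (F : SigmaB (n + 1) → M) :
    ∑ σ, F σ = ∑ k, ∑ s, ∑ τ, F (extend k s τ) := by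
  simp only [← (extend_bijective n).sum_comp F, Fintype.sum_prod_type]

theorem negCount_extend (k : Fin (n + 1)) (s : ℤˣ) (τ : SigmaB n) :
    negCount (extend k s τ) = (if s = -1 then 1 else 0) + negCount τ := by
  rw [negCount, Fin.sum_univ_succAbove _ k]
  simp [negCount]

theorem sum_lt_succAbove {M : Type*} [AddCommMonoid M] (k : Fin (n + 1))
    (F : Fin (n + 1) → Fin (n + 1) → M) :
    ∑ p : Fin (n + 1) × Fin (n + 1) with p.1 < p.2, F p.1 p.2 =
      ∑ j with k < k.succAbove j, F k (k.succAbove j) +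
        ∑ i with k.succAbove i < k, F (k.succAbove i) k +
          ∑ p : Fin n × Fin n with p.1 < p.2, F (k.succAbove p.1) (k.succAbove p.2) := by
  simp only [Finset.sum_filter, Fintype.sum_prod_type, Fin.sum_univ_succAbove _ k,
    lt_self_iff_false, if_false, zero_add, Fin.succAbove_lt_succAbove_iff, Finset.sum_add_distrib,
    add_assoc]

theorem card_succAbove_lt (k : Fin (n + 1)) :
    (Finset.univ.filter fun j : Fin n => k.succAbove j < k).card = k := by
  simp only [Fin.succAbove_lt_iff_castSucc_lt]
  simp only [Fin.lt_def, Fin.val_castSucc, Fin.card_filter_val_lt,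
    min_eq_right (Nat.le_of_lt_succ k.2)]

theorem card_lt_succAbove (k : Fin (n + 1)) :
    (Finset.univ.filter fun j : Fin n => k < k.succAbove j).card = n - k := by
  have h := Finset.card_filter_add_card_filter_not (s := Finset.univ)
    fun j : Fin n => k.succAbove j < k
  simp only [not_lt, (Fin.ne_succAbove k _).le_iff_lt, card_succAbove_lt,
    Finset.card_univ, Fintype.card_fin] at h
  omega

theorem invCount_extend (k : Fin (n + 1)) (s : ℤˣ) (τ : SigmaB n) :
    invCount (extend k s τ) =
      n - k + (if s = -1 then 2 * (k : ℕ) else 0) + invCount τ := by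
  have hlast : ∀ i : Fin n, ¬ Fin.last n < i.castSucc := fun i => (Fin.le_last _).not_gt
  rw [invCount, sum_lt_succAbove k (invWeight (extend k s τ))]
  simp [invWeight, Fin.castSucc_lt_last, hlast, card_succAbove_lt, card_lt_succAbove, invCount,
    mul_comm]

end SignedPermutations

/-! ### The annihilation operator as a contraction -/

section FockSpace

variable {H : Type*} [NormedAddCommGroup H] [InnerProductSpace ℂ H]

/-- The element `y_1 ⊗ ⋯ ⊗ y_m` of the Fock space. -/
noncomputable def pureTensor {m : ℕ} (y : Fin m → H) : Fock H :=
  DirectSum.lof ℂ ℕ (fun n => ⨂[ℂ]^n H) m (PiTensorProduct.tprod ℂ y)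

theorem vacuum_eq_pureTensor (y : Fin 0 → H) : vacuum H = pureTensor y := by
  rw [Subsingleton.elim y Fin.elim0]; rfl

@[elab_as_elim]
theorem fock_induction {P : Fock H → Prop} (pure : ∀ (m : ℕ) (y : Fin m → H), P (pureTensor y))
    (add : ∀ f g, P f → P g → P (f + g)) (smul : ∀ (c : ℂ) f, P f → P (c • f)) (f : Fock H) :
    P f := by
  induction f using DirectSum.induction_on with
  | zero => simpa using smul 0 _ (pure 0 Fin.elim0)
  | of m t =>
    change P (DirectSum.lof ℂ ℕ (fun n => ⨂[ℂ]^n H) m t)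
    induction t using PiTensorProduct.induction_on with
    | smul_tprod r y => rw [map_smul]; exact smul _ _ (pure m y)
    | add s t hs ht => rw [map_add]; exact add _ _ hs ht
  | add f g hf hg => exact add _ _ hf hg

/-- `z` or `z̄`, according to a sign. -/
def signBar (J : H →ₗ[ℂ] H) (s : ℤˣ) (z : H) : H := if s = 1 then z else J z

@[simp] theorem signBar_one (J : H →ₗ[ℂ] H) (z : H) : signBar J 1 z = z := if_pos rfl

@[simp] theorem signBar_neg_one (J : H →ₗ[ℂ] H) (z : H) : signBar J (-1) z = J z :=
  if_neg (by decide)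

theorem inner_signBar {J : H →ₗ[ℂ] H} (hJ : J.IsSymmetric) (s : ℤˣ) (y z : H) :
    inner ℂ (signBar J s y) z = inner ℂ y (signBar J s z) := by
  obtain rfl | rfl := Int.units_eq_one_or s
  · simp
  · simpa using hJ y z

/-- The form `⟨·,·⟩_{α,q}` on the elementary tensors of degree `n`. -/
noncomputable def symForm (α q : ℝ) (J : H →ₗ[ℂ] H) {n : ℕ} (y z : Fin n → H) : ℂ :=
  ∑ σ : SigmaB n, (α : ℂ) ^ negCount σ * (q : ℂ) ^ invCount σ *
    ∏ k, inner ℂ (y (absPerm σ k)) (signBar J (sgn σ k) (z k))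

section Form

variable (α q : ℝ) (J : H →ₗ[ℂ] H)

theorem tensorForm_symmetrization {n : ℕ} (y z : Fin n → H) :
    tensorForm n (symmetrization α q J n (PiTensorProduct.tprod ℂ z))
      (PiTensorProduct.tprod ℂ y) = symForm α q J y z := by
  simp only [symmetrization, LinearMap.sum_apply, LinearMap.smul_apply, map_sum, map_smul,
    act_tprod, tensorForm_tprod, symForm, l₁_eq_negCount, l₂_eq_invCount, smul_eq_mul]
  refine Finset.sum_congr rfl fun σ _ => ?_
  rw [← Equiv.prod_comp (absPerm σ)]
  simp [signBar]

theorem fockInner_pureTensor {n : ℕ} (y z : Fin n → H) :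
    fockInner α q J (pureTensor y) (pureTensor z) = symForm α q J y z := by
  rw [pureTensor, pureTensor, fockInner_lof, DirectSum.lof_apply, tensorForm_symmetrization]

theorem fockInner_pureTensor_of_ne {m n : ℕ} (h : m ≠ n) (y : Fin m → H) (z : Fin n → H) :
    fockInner α q J (pureTensor y) (pureTensor z) = 0 := by
  rw [pureTensor, pureTensor, fockInner_lof, DirectSum.lof_eq_of,
    DirectSum.of_eq_of_ne _ _ _ h.symm, map_zero]

theorem fockInner_vacuum_pureTensor {m : ℕ} (y : Fin m → H) :
    fockInner α q J (vacuum H) (pureTensor y) = if m = 0 then 1 else 0 := by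
  rw [vacuum_eq_pureTensor Fin.elim0]
  split_ifs with h
  · subst h
    rw [fockInner_pureTensor]
    simp [symForm, negCount, invCount, card_sigmaB]
  · exact fockInner_pureTensor_of_ne _ _ _ (Ne.symm h) _ _

variable {J} in
theorem symForm_conj (hJ : J.IsSymmetric) {n : ℕ} (y z : Fin n → H) :
    starRingEnd ℂ (symForm α q J y z) = symForm α q J z y := by
  simp only [symForm, map_sum, map_mul, map_pow, Complex.conj_ofReal, map_prod, inner_conj_symm]
  rw [← Equiv.sum_comp (Equiv.inv (SigmaB n))]
  refine Finset.sum_congr rfl fun σ _ => ?_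
  rw [Equiv.inv_apply, negCount_inv, invCount_inv, ← Equiv.prod_comp (absPerm σ)]
  simp only [absPerm_inv_apply, sgn_inv_apply, inner_signBar hJ]

variable {J} in
theorem fockInner_conj (hJ : J.IsSymmetric) (f g : Fock H) :
    starRingEnd ℂ (fockInner α q J f g) = fockInner α q J g f := by
  induction f using fock_induction with
  | add f f' hf hf' => simp_all [fockInner]
  | smul c f hf => simp_all [fockInner]
  | pure m y =>
    induction g using fock_induction with
    | add g g' hg hg' => simp_all [fockInner]
    | smul c g hg => simp_all [fockInner]
    | pure n z =>
      obtain rfl | h := eq_or_ne m n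
      · rw [fockInner_pureTensor, fockInner_pureTensor, symForm_conj _ _ hJ]
      · rw [fockInner_pureTensor_of_ne _ _ _ h, fockInner_pureTensor_of_ne _ _ _ h.symm, map_zero]

/-- The functional `z ↦ q^{m-k} (⟨x, z⟩ + α q^{2k} ⟨x, z̄⟩)` which `b(x)` applies to the factor in
position `k` (counted from `0`) of an elementary tensor with `m + 1` factors. -/
noncomputable def contraction {m : ℕ} (x : H) (k : Fin (m + 1)) : H →ₗ[ℂ] ℂ :=
  (q : ℂ) ^ (m - (k : ℕ)) •
    (innerₛₗ ℂ x + ((α : ℂ) * (q : ℂ) ^ (2 * (k : ℕ))) • (innerₛₗ ℂ x ∘ₗ J))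

theorem contraction_apply {m : ℕ} (x : H) (k : Fin (m + 1)) (z : H) :
    contraction α q J x k z = (q : ℂ) ^ (m - (k : ℕ)) *
      (inner ℂ x z + (α : ℂ) * (q : ℂ) ^ (2 * (k : ℕ)) * inner ℂ x (J z)) := by
  simp [contraction, mul_add]

theorem prod_inner_extend {m : ℕ} (y : Fin m → H) (x : H) (z : Fin (m + 1) → H)
    (k : Fin (m + 1)) (s : ℤˣ) (τ : SigmaB m) :
    ∏ j, inner ℂ ((Fin.snoc y x : Fin (m + 1) → H) (absPerm (extend k s τ) j))
        (signBar J (sgn (extend k s τ) j) (z j)) =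
      inner ℂ x (signBar J s (z k)) *
        ∏ j, inner ℂ (y (absPerm τ j)) (signBar J (sgn τ j) (z (k.succAbove j))) := by
  rw [Fin.prod_univ_succAbove _ k]
  simp

theorem symForm_snoc {m : ℕ} (y : Fin m → H) (x : H) (z : Fin (m + 1) → H) :
    symForm α q J (Fin.snoc y x : Fin (m + 1) → H) z =
      ∑ k, contraction α q J x k (z k) * symForm α q J y (z ∘ k.succAbove) := by
  have hne : (1 : ℤˣ) ≠ -1 := by decide
  rw [symForm, sum_sigmaB_succ]
  refine Finset.sum_congr rfl fun k _ => ?_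
  simp only [UnitsInt.univ, Finset.sum_pair hne, ← Finset.sum_add_distrib, symForm, Finset.mul_sum,
    prod_inner_extend, negCount_extend, invCount_extend, contraction_apply, if_neg hne, if_true,
    signBar_one, signBar_neg_one, Function.comp_apply, pow_add, pow_zero, pow_one]
  refine Finset.sum_congr rfl fun τ _ => ?_
  ring

/-- The operator `y_0 ⊗ ⋯ ⊗ y_m ↦ ∑_k q^{m-k} (⟨x, y_k⟩ + α q^{2k} ⟨x, ȳ_k⟩)
y_0 ⊗ ⋯ ŷ_k ⋯ ⊗ y_m`, which is the annihilation operator `b(x)`. -/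
noncomputable def contractOp (x : H) : Module.End ℂ (Fock H) :=
  DirectSum.toModule ℂ ℕ (Fock H) fun n =>
    match n with
    | 0 => 0
    | m + 1 => DirectSum.lof ℂ ℕ (fun n => ⨂[ℂ]^n H) m ∘ₗ
        PiTensorProduct.lift (∑ k : Fin (m + 1),
          LinearMap.uncurryMid (M := fun _ : Fin (m + 1) => H) k
            ((contraction α q J x k).smulRight
              (PiTensorProduct.tprod ℂ (s := fun _ : Fin m => H))))

theorem contractOp_pureTensor_zero (x : H) (y : Fin 0 → H) :
    contractOp α q J x (pureTensor y) = 0 := by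
  rw [contractOp, pureTensor, DirectSum.toModule_lof]
  rfl

theorem contractOp_pureTensor_succ (x : H) {m : ℕ} (y : Fin (m + 1) → H) :
    contractOp α q J x (pureTensor y) =
      ∑ k, contraction α q J x k (y k) • pureTensor (y ∘ k.succAbove) := by
  rw [contractOp, pureTensor, DirectSum.toModule_lof]
  change DirectSum.lof ℂ ℕ (fun n => ⨂[ℂ]^n H) m (PiTensorProduct.lift _ _) = _
  rw [PiTensorProduct.lift.tprod, sum_apply, map_sum]
  refine Finset.sum_congr rfl fun k _ => ?_
  rw [LinearMap.uncurryMid_apply, LinearMap.smulRight_apply, smul_apply, map_smul]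
  rfl

theorem fockInner_apply_contractOp_pureTensor (f : Fock H) (A : Module.End ℂ (Fock H)) (x : H)
    {m : ℕ} (y : Fin (m + 1) → H) :
    fockInner α q J f (A (contractOp α q J x (pureTensor y))) =
      ∑ k, contraction α q J x k (y k) *
        fockInner α q J f (A (pureTensor (y ∘ k.succAbove))) := by
  simp [fockInner, contractOp_pureTensor_succ]

theorem creation_pureTensor (x : H) {m : ℕ} (y : Fin m → H) :
    creation x (pureTensor y) = pureTensor (Fin.snoc y x : Fin (m + 1) → H) :=
  creation_tprod x y

theorem fockInner_creation_pureTensor (x : H) {m n : ℕ} (y : Fin m → H) (z : Fin n → H) :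
    fockInner α q J (creation x (pureTensor y)) (pureTensor z) =
      fockInner α q J (pureTensor y) (contractOp α q J x (pureTensor z)) := by
  rw [creation_pureTensor]
  cases n with
  | zero =>
    rw [contractOp_pureTensor_zero, fockInner_pureTensor_of_ne _ _ _ m.succ_ne_zero]
    simp [fockInner]
  | succ n =>
    refine Eq.trans ?_ (fockInner_apply_contractOp_pureTensor α q J _ 1 x z).symm
    simp only [Module.End.one_apply]
    obtain rfl | h := eq_or_ne m n
    · simp only [fockInner_pureTensor, symForm_snoc]
    · rw [fockInner_pureTensor_of_ne _ _ _ (by omega)]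
      simp [fockInner_pureTensor_of_ne _ _ _ h]

theorem isCreationAdjoint_contractOp (x : H) :
    IsCreationAdjoint α q J x (contractOp α q J x) := by
  intro f g
  induction f using fock_induction with
  | add f f' hf hf' => simp_all [fockInner]
  | smul c f hf => simp_all [fockInner]
  | pure m y =>
    induction g using fock_induction with
    | add g g' hg hg' => simp_all [fockInner]
    | smul c g hg => simp_all [fockInner]
    | pure n z => exact fockInner_creation_pureTensor α q J x y z

theorem isCreationAdjoint_annihilation (x : H) :
    IsCreationAdjoint α q J x (annihilation α q J x) := by
  have h : ∃ T, IsCreationAdjoint α q J x T := ⟨_, isCreationAdjoint_contractOp α q J x⟩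
  rw [annihilation, dif_pos h]
  exact h.choose_spec

end Form

/-! ### Words in the ladder operators -/

theorem isAdjointPair_prod {R M N ι : Type*} [CommSemiring R] [AddCommMonoid M] [Module R M]
    [AddCommMonoid N] [Module R N] {I : R →+* R} {B : M →ₗ[R] M →ₛₗ[I] N}
    {A A' : ι → Module.End R M} (h : ∀ i, B.IsAdjointPair B (A i) (A' i)) (l : List ι) :
    B.IsAdjointPair B (l.map A).prod (l.map A').reverse.prod := by
  induction l with
  | nil => exact fun _ _ => rfl
  | cons i l ih => simpa using (h i).mul ih

variable {α q : ℝ} {J : H →ₗ[ℂ] H}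

theorem IsCreationAdjoint.isAdjointPair {x : H} {T : Module.End ℂ (Fock H)}
    (h : IsCreationAdjoint α q J x T) :
    (fockForm α q J).IsAdjointPair (fockForm α q J) T (creation x) :=
  fun g f => (h f g).symm

theorem isAdjointPair_fockForm_symm (hJ : J.IsSymmetric) {A A' : Module.End ℂ (Fock H)}
    (h : (fockForm α q J).IsAdjointPair (fockForm α q J) A A') :
    (fockForm α q J).IsAdjointPair (fockForm α q J) A' A := by
  intro f g
  change fockInner α q J g (A' f) = fockInner α q J (A g) f
  rw [← fockInner_conj α q hJ, ← fockInner_conj α q hJ f]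
  exact congrArg (starRingEnd ℂ) (h g f).symm

variable (α q J) in
/-- The operator `b^*(z) + b(w)`, with the explicit formula for `b(w)`. The pairs
`(z, w) = (x, 0), (0, x), (x, x)` give `b^*(x)`, `b(x)`, `G(x)`. -/
noncomputable def ladderOp (z w : H) : Module.End ℂ (Fock H) :=
  creation z + contractOp α q J w

theorem creation_zero : creation (0 : H) = 0 := by
  ext; simp [creation]

theorem contractOp_zero : contractOp α q J 0 = 0 := by
  ext (_ | m) <;> simp [contractOp, contraction]

theorem isAdjointPair_gaussian (hJ : J.IsSymmetric) (x : H) :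
    (fockForm α q J).IsAdjointPair (fockForm α q J) (gaussian α q J x) (gaussian α q J x) := by
  have h := (isCreationAdjoint_annihilation α q J x).isAdjointPair
  have hsum := h.add (isAdjointPair_fockForm_symm hJ h)
  rwa [add_comm (⇑(creation x))] at hsum

theorem isAdjointPair_ladderOp_gaussian (hJ : J.IsSymmetric) (x : H) :
    (fockForm α q J).IsAdjointPair (fockForm α q J) (ladderOp α q J x x)
      (gaussian α q J x) := by
  have h := isAdjointPair_fockForm_symm hJ (isCreationAdjoint_annihilation α q J x).isAdjointPair
  have hsum := h.add (isCreationAdjoint_contractOp α q J x).isAdjointPair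
  exact hsum

/-- The vector which `b^ε(x)` creates. -/
def Exponent.created : Exponent → H → H
  | one, _ => 0
  | star, x => x

/-- The vector which `b^ε(x)` annihilates. -/
def Exponent.annihilated : Exponent → H → H
  | one, x => x
  | star, _ => 0

/-- The adjoint of `b^ε(x)`. -/
noncomputable def bOpAdjoint (α q : ℝ) (J : H →ₗ[ℂ] H) : Exponent → H → Module.End ℂ (Fock H)
  | Exponent.one, x => creation x
  | Exponent.star, x => annihilation α q J x

theorem isAdjointPair_bOp (hJ : J.IsSymmetric) (e : Exponent) (x : H) :
    (fockForm α q J).IsAdjointPair (fockForm α q J) (bOp α q J e x) (bOpAdjoint α q J e x) := by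
  have h := (isCreationAdjoint_annihilation α q J x).isAdjointPair
  cases e
  · exact h
  · exact isAdjointPair_fockForm_symm hJ h

theorem isAdjointPair_ladderOp_bOp (hJ : J.IsSymmetric) (e : Exponent) (x : H) :
    (fockForm α q J).IsAdjointPair (fockForm α q J)
      (ladderOp α q J (e.created x) (e.annihilated x)) (bOpAdjoint α q J e x) := by
  cases e <;> simp only [ladderOp, Exponent.created, Exponent.annihilated, creation_zero,
    contractOp_zero, zero_add, add_zero]
  · exact (isCreationAdjoint_contractOp α q J x).isAdjointPair
  · exact isAdjointPair_fockForm_symm hJ (isCreationAdjoint_annihilation α q J x).isAdjointPair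

theorem fockInner_prod_eq_of_isAdjointPair {n : ℕ} {A B A' : Fin n → Module.End ℂ (Fock H)}
    (hA : ∀ i, (fockForm α q J).IsAdjointPair (fockForm α q J) (A i) (A' i))
    (hB : ∀ i, (fockForm α q J).IsAdjointPair (fockForm α q J) (B i) (A' i)) (f g : Fock H) :
    fockInner α q J f ((List.ofFn A).reverse.prod g) =
      fockInner α q J f ((List.ofFn B).reverse.prod g) := by
  simp only [List.ofFn_eq_map, ← List.map_reverse]
  exact (isAdjointPair_prod hA _ g f).trans (isAdjointPair_prod hB _ g f).symm

end FockSpace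

/-! ### Pairings with open points -/

section Pairings

section Structure

variable {ι : Type*} [DecidableEq ι]

/-- `P` is a partition of `S` into pairs. -/
def IsPairing (S : Finset ι) (P : Finset (Finset ι)) : Prop :=
  (∀ V ∈ P, V.card = 2) ∧ (P : Set (Finset ι)).PairwiseDisjoint id ∧ P.sup id = S

theorem isPairing_insert_iff {S B : Finset ι} {P : Finset (Finset ι)} (hB : B ∉ P) :
    IsPairing S (insert B P) ↔ B.card = 2 ∧ B ⊆ S ∧ IsPairing (S \ B) P := by
  simp only [IsPairing, Finset.forall_mem_insert, Finset.coe_insert, Finset.sup_insert, id,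
    Set.pairwiseDisjoint_insert_of_notMem (Finset.mem_coe.not.2 hB), Finset.sup_eq_union]
  have hsup : (∀ V ∈ (P : Set (Finset ι)), Disjoint B V) ↔ Disjoint B (P.sup id) := by
    simp [Finset.disjoint_sup_right]
  rw [hsup]
  constructor
  · rintro ⟨⟨hB2, hP2⟩, ⟨hP, hdisj⟩, rfl⟩
    exact ⟨hB2, Finset.subset_union_left, hP2, hP, (Finset.union_sdiff_cancel_left hdisj).symm⟩
  · rintro ⟨hB2, hBS, hP2, hP, hS⟩
    exact ⟨⟨hB2, hP2⟩, ⟨hP, hS ▸ Finset.disjoint_sdiff⟩, hS ▸ Finset.union_sdiff_of_subset hBS⟩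

open Classical in
/-- The pairings of `L ∪ R` without a pair inside `L`: the completions of a partial pairing whose
open points are `L`, where the points of `R` are still to come. -/
noncomputable def openPairings (L R : Finset ι) : Finset (Finset (Finset ι)) :=
  (L ∪ R).powerset.powerset.filter fun P => IsPairing (L ∪ R) P ∧ ∀ V ∈ P, ¬ V ⊆ L

variable {L R : Finset ι} {P : Finset (Finset ι)} {a T : ι}

theorem IsPairing.subset {S V : Finset ι} (h : IsPairing S P) (hV : V ∈ P) : V ⊆ S :=
  h.2.2 ▸ Finset.le_sup (f := id) hV

theorem mem_openPairings :
    P ∈ openPairings L R ↔ IsPairing (L ∪ R) P ∧ ∀ V ∈ P, ¬ V ⊆ L := by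
  classical
  rw [openPairings, Finset.mem_filter, and_iff_right_iff_imp, Finset.mem_powerset]
  exact fun h V hV => Finset.mem_powerset.2 (h.1.subset hV)

theorem mem_openPairings_empty {S : Finset ι} :
    P ∈ openPairings ∅ S ↔ IsPairing S P := by
  rw [mem_openPairings, Finset.empty_union, and_iff_left_iff_imp]
  rintro h V hV hV'
  have hcard := h.1 V hV
  simp [Finset.subset_empty.1 hV'] at hcard

theorem openPairings_empty_right (L : Finset ι) :
    openPairings L ∅ = if L = ∅ then {∅} else ∅ := by
  have hP : ∀ P, P ∈ openPairings L ∅ ↔ P = ∅ ∧ L = ∅ := by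
    intro P
    rw [mem_openPairings, Finset.union_empty]
    constructor
    · rintro ⟨h, hL⟩
      obtain rfl : P = ∅ :=
        Finset.eq_empty_of_forall_notMem fun V hV => hL V hV (h.subset hV)
      exact ⟨rfl, h.2.2.symm⟩
    · rintro ⟨rfl, rfl⟩
      simp [IsPairing]
  ext P
  split_ifs <;> simp_all

theorem notMem_of_mem_openPairings (hL : T ∉ L) (hR : T ∉ R) (hP : P ∈ openPairings L R)
    {V : Finset ι} (hV : V ∈ P) : T ∉ V := fun hT =>
  Finset.notMem_union.2 ⟨hL, hR⟩ ((mem_openPairings.1 hP).1.subset hV hT)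

theorem mem_openPairings_insert_left :
    P ∈ openPairings (insert T L) R ↔
      P ∈ openPairings L (insert T R) ∧ ∀ a ∈ L, {a, T} ∉ P := by
  rw [mem_openPairings, mem_openPairings, Finset.insert_union, Finset.union_insert, and_assoc]
  refine and_congr_right fun hP => ⟨fun h => ⟨fun V hV hVL => ?_, fun a ha hB => ?_⟩,
    fun ⟨h, hB⟩ V hV hVL => ?_⟩
  · exact h V hV (hVL.trans (Finset.subset_insert _ _))
  · exact h _ hB (by simp [Finset.insert_subset_iff, ha])
  · by_cases hTV : T ∈ V
    · obtain ⟨a, haT⟩ := Finset.card_eq_one.1 (show (V.erase T).card = 1 by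
        rw [Finset.card_erase_of_mem hTV, hP.1 V hV])
      have ha : a ∈ V.erase T := by simp [haT]
      refine hB a (Finset.mem_of_mem_insert_of_ne (hVL (Finset.mem_of_mem_erase ha))
        (Finset.ne_of_mem_erase ha)) ?_
      rwa [Finset.pair_comm, ← haT, Finset.insert_erase hTV]
    · exact h V hV ((Finset.subset_insert_iff_of_notMem hTV).1 hVL)

theorem insert_pair_mem_openPairings (hLR : Disjoint L R) (hTL : T ∉ L) (hTR : T ∉ R)
    (ha : a ∈ L) (hB : {a, T} ∉ P) :
    insert {a, T} P ∈ openPairings L (insert T R) ↔ P ∈ openPairings (L.erase a) R := by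
  have haT : a ≠ T := ne_of_mem_of_not_mem ha hTL
  have haR : a ∉ R := Finset.disjoint_left.1 hLR ha
  have hS : (L ∪ insert T R) \ {a, T} = L.erase a ∪ R := by grind
  have hBS : {a, T} ⊆ L ∪ insert T R := by grind
  have hBL : ¬ {a, T} ⊆ L := by grind
  rw [mem_openPairings, mem_openPairings, isPairing_insert_iff hB, hS, Finset.forall_mem_insert]
  simp only [Finset.card_pair haT, hBS, hBL, not_false_eq_true, true_and]
  refine and_congr_right fun hP => forall₂_congr fun V hV => not_congr ?_
  have haV : a ∉ V := fun h => by simpa [haR] using hP.subset hV h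
  rw [Finset.subset_erase, and_iff_left haV]

theorem disjoint_openPairings_image {a' : ι} (hTL : T ∉ L) (hTR : T ∉ R) (ha : a ∈ L)
    (haa : a ≠ a') :
    Disjoint ((openPairings (L.erase a) R).image (insert {a, T}))
      ((openPairings (L.erase a') R).image (insert {a', T})) := by
  simp only [Finset.disjoint_left, Finset.mem_image, not_exists, not_and]
  rintro _ ⟨P, _, rfl⟩ P' hP' heq
  have hB : {a, T} ∈ insert {a', T} P' := heq ▸ Finset.mem_insert_self _ _
  have hTP' : {a, T} ∉ P' := fun h =>
    notMem_of_mem_openPairings (fun hT => hTL (Finset.mem_of_mem_erase hT)) hTR hP' h (by simp)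
  have haT : a ≠ T := ne_of_mem_of_not_mem ha hTL
  have hmem : a ∈ ({a', T} : Finset ι) :=
    (Finset.mem_insert.1 hB).resolve_right hTP' ▸ Finset.mem_insert_self _ _
  simp [haa, haT] at hmem

theorem sum_openPairings_insert {M : Type*} [AddCommMonoid M] (hLR : Disjoint L R) (hTL : T ∉ L)
    (hTR : T ∉ R) (F : Finset (Finset ι) → M) :
    ∑ P ∈ openPairings L (insert T R), F P = ∑ P ∈ openPairings (insert T L) R, F P +
      ∑ a ∈ L, ∑ P ∈ openPairings (L.erase a) R, F (insert {a, T} P) := by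
  have hB : ∀ a, ∀ P ∈ openPairings (L.erase a) R, {a, T} ∉ P := fun a P hP h =>
    notMem_of_mem_openPairings (fun hT => hTL (Finset.mem_of_mem_erase hT)) hTR hP h (by simp)
  have hsplit : openPairings L (insert T R) = openPairings (insert T L) R ∪
      L.biUnion fun a => (openPairings (L.erase a) R).image (insert {a, T}) := by
    ext P
    simp only [Finset.mem_union, Finset.mem_biUnion, Finset.mem_image,
      mem_openPairings_insert_left]
    constructor
    · intro hP
      by_cases h : ∀ a ∈ L, {a, T} ∉ P
      · exact Or.inl ⟨hP, h⟩
      · push Not at h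
        obtain ⟨a, ha, haP⟩ := h
        refine Or.inr ⟨a, ha, P.erase {a, T}, ?_, Finset.insert_erase haP⟩
        rwa [← insert_pair_mem_openPairings hLR hTL hTR ha (Finset.notMem_erase _ _),
          Finset.insert_erase haP]
    · rintro (hP | ⟨a, ha, P, hP, rfl⟩)
      · exact hP.1
      · exact (insert_pair_mem_openPairings hLR hTL hTR ha (hB a P hP)).2 hP
  rw [hsplit, Finset.sum_union, Finset.sum_biUnion]
  · congr 1
    refine Finset.sum_congr rfl fun a _ => Finset.sum_image fun P hP P' hP' h => ?_
    rw [← Finset.erase_insert (hB a P hP), h, Finset.erase_insert (hB a P' hP')]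
  · exact fun a ha a' _ h => disjoint_openPairings_image hTL hTR ha h
  · simp only [Finset.disjoint_left, Finset.mem_biUnion, Finset.mem_image,
      mem_openPairings_insert_left]
    rintro P hP ⟨a, ha, P, -, rfl⟩
    exact hP.2 a ha (Finset.mem_insert_self _ _)

theorem card_filter_openPairings (hP : P ∈ openPairings L R) (p : ι → Prop) [DecidablePred p]
    [DecidablePred fun V : Finset ι => ∃ l ∈ V, l ∈ L ∧ p l] :
    (P.filter fun V => ∃ l ∈ V, l ∈ L ∧ p l).card = (L.filter p).card := by
  obtain ⟨⟨hcard, hdisj, hsup⟩, hPL⟩ := mem_openPairings.1 hP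
  have hcover : ∀ l ∈ L, ∃ V ∈ P, l ∈ V := fun l hl => by
    simpa using (hsup ▸ Finset.mem_union_left R hl : l ∈ P.sup id)
  choose! f hfP hf using hcover
  symm
  refine Finset.card_bij (fun l _ => f l) ?_ ?_ ?_
  · intro l hl
    rw [Finset.mem_filter] at hl
    exact Finset.mem_filter.2 ⟨hfP l hl.1, l, hf l hl.1, hl⟩
  · intro l hl l' hl' h
    rw [Finset.mem_filter] at hl hl'
    by_contra hne
    have hsub : {l, l'} ⊆ f l := by
      simp [Finset.insert_subset_iff, hf l hl.1, h ▸ hf l' hl'.1]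
    refine hPL _ (hfP l hl.1) ?_
    rw [← Finset.eq_of_subset_of_card_le hsub (by rw [hcard _ (hfP l hl.1), Finset.card_pair hne])]
    simp [Finset.insert_subset_iff, hl.1, hl'.1]
  · intro V hV
    obtain ⟨hV, l, hlV, hlL, hpl⟩ := Finset.mem_filter.1 hV
    exact ⟨l, Finset.mem_filter.2 ⟨hlL, hpl⟩,
      hdisj.elim_finset (hfP l hlL) hV l (hf l hlL) hlV⟩

open Classical in
theorem card_filter_powersetCard_two_insert (r : ι → ι → Prop) {b : ι} {s : Finset ι}
    (hb : b ∉ s) :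
    (((insert b s).powersetCard 2).filter fun S => ∃ v ∈ S, ∃ w ∈ S, v ≠ w ∧ r v w).card =
      ((s.powersetCard 2).filter fun S => ∃ v ∈ S, ∃ w ∈ S, v ≠ w ∧ r v w).card +
        (s.filter fun v => r b v ∨ r v b).card := by
  have hpair : ∀ v ∈ s, (∃ x ∈ ({b, v} : Finset ι), ∃ y ∈ ({b, v} : Finset ι), x ≠ y ∧ r x y) ↔
      r b v ∨ r v b := by
    intro v hv
    have hbv : b ≠ v := (ne_of_mem_of_not_mem hv hb).symm
    simp [hbv, hbv.symm]
  have himage : ((s.powersetCard 1).image (insert b)).filter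
      (fun S => ∃ v ∈ S, ∃ w ∈ S, v ≠ w ∧ r v w) =
        (s.filter fun v => r b v ∨ r v b).image fun v => {b, v} := by
    rw [Finset.powersetCard_one, Finset.map_eq_image, Finset.image_image, Finset.filter_image]
    congr 1
    exact Finset.filter_congr hpair
  have hinj : Set.InjOn (fun v => ({b, v} : Finset ι)) (s.filter fun v => r b v ∨ r v b) := by
    intro v hv w _ h
    have hbv : b ≠ v := (ne_of_mem_of_not_mem (Finset.mem_filter.1 hv).1 hb).symm
    have hvw : v ∈ ({b, w} : Finset ι) := (Finset.ext_iff.1 h v).1 (by simp)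
    simpa [hbv.symm] using hvw
  rw [Finset.powersetCard_succ_insert hb, Finset.filter_union, Finset.card_union_of_disjoint,
    himage, Finset.card_image_of_injOn hinj]
  refine Finset.disjoint_filter_filter (Finset.disjoint_left.2 fun S hS hS' => ?_)
  obtain ⟨S, -, rfl⟩ := Finset.mem_image.1 hS'
  exact hb ((Finset.mem_powersetCard.1 hS).1 (Finset.mem_insert_self _ _))

end Structure

section Statistics

variable {n : ℕ}

/-- `V` and `W` cross, and the leftmost of the four points is in `V`. -/
def Crosses (V W : Finset (Fin n)) : Prop :=
  ∃ i ∈ V, ∃ j ∈ V, ∃ k ∈ W, ∃ l ∈ W, i < k ∧ k < j ∧ j < l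

theorem crosses_pair_iff {i j k l : Fin n} (hij : i < j) (hkl : k < l) :
    Crosses {i, j} {k, l} ↔ i < k ∧ k < j ∧ j < l := by
  simp only [Crosses, Finset.mem_insert, Finset.mem_singleton, exists_eq_or_imp, exists_eq_left]
  omega

theorem covers_pair_iff {i j k l : Fin n} (hij : i < j) (hkl : k < l) :
    Covers {i, j} {k, l} ↔ i < k ∧ l < j := by
  simp only [Covers, Finset.mem_insert, Finset.mem_singleton, exists_eq_or_imp, exists_eq_left,
    forall_eq_or_imp, forall_eq]
  omega

open Classical in
/-- `Cr` of a set of blocks which need not exhaust `[n]`. -/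
noncomputable def crossingCount (P : Finset (Finset (Fin n))) : ℕ :=
  ((P.powersetCard 2).filter fun S => ∃ V ∈ S, ∃ W ∈ S, V ≠ W ∧ Crosses V W).card

open Classical in
/-- `Cov` for a set of blocks which need not exhaust `[n]`. -/
noncomputable def coverCount (P : Finset (Finset (Fin n))) (V : Finset (Fin n)) : ℕ :=
  (P.filter fun W => Covers W V).card

variable {L R : Finset (Fin n)} {P : Finset (Finset (Fin n))} {a T : Fin n}

theorem exists_eq_pair_of_mem_openPairings (hL : ∀ l ∈ L, l < T) (hR : ∀ t ∈ R, T < t)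
    (hP : P ∈ openPairings L R) {V : Finset (Fin n)} (hV : V ∈ P) :
    ∃ c b, c < b ∧ T < b ∧ V = {c, b} ∧ (c ∈ L ↔ c < T) := by
  obtain ⟨hpair, hPL⟩ := mem_openPairings.1 hP
  obtain ⟨b, hbV, hbL⟩ := Finset.not_subset.1 (hPL V hV)
  have hsub : ∀ v ∈ V, v ∈ L ∨ v ∈ R := fun v hv => Finset.mem_union.1 (hpair.subset hV hv)
  have hmem : ∀ v ∈ V, (v ∈ L ↔ v < T) := fun v hv =>
    ⟨hL v, fun h => (hsub v hv).resolve_right fun hvR => lt_asymm h (hR v hvR)⟩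
  have hTb : T < b := hR b ((hsub b hbV).resolve_left hbL)
  obtain ⟨u, v, huv, rfl⟩ := Finset.card_eq_two.1 (hpair.1 V hV)
  have hTuv : T < max u v := by
    obtain rfl | rfl : b = u ∨ b = v := by simpa using hbV
    exacts [lt_max_of_lt_left hTb, lt_max_of_lt_right hTb]
  refine ⟨min u v, max u v, min_lt_max.2 huv, hTuv, ?_, hmem _ ?_⟩
  · obtain h | h := le_total u v
    · rw [min_eq_left h, max_eq_right h]
    · rw [min_eq_right h, max_eq_left h, Finset.pair_comm]
  · obtain h | h := min_choice u v <;> simp [h]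

theorem crossingCount_insert_pair (hL : ∀ l ∈ L, l < T) (hR : ∀ t ∈ R, T < t) (ha : a ∈ L)
    (hP : P ∈ openPairings (L.erase a) R) (hB : {a, T} ∉ P) :
    crossingCount (insert {a, T} P) = crossingCount P + (L.filter (a < ·)).card := by
  classical
  have hfilter : P.filter (fun V => Crosses {a, T} V ∨ Crosses V {a, T}) =
      P.filter fun V => ∃ l ∈ V, l ∈ L.erase a ∧ a < l := by
    refine Finset.filter_congr fun V hV => ?_
    obtain ⟨c, b, hcb, hTb, rfl, hc⟩ := exists_eq_pair_of_mem_openPairings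
      (fun l hl => hL l (Finset.mem_of_mem_erase hl)) hR hP hV
    have hb : b ∉ L.erase a := fun h => lt_asymm hTb (hL b (Finset.mem_of_mem_erase h))
    rw [crosses_pair_iff (hL a ha) hcb, crosses_pair_iff hcb (hL a ha)]
    simp only [Finset.mem_insert, Finset.mem_singleton, exists_eq_or_imp, exists_eq_left, hc, hb]
    grind
  rw [crossingCount, card_filter_powersetCard_two_insert _ hB, ← crossingCount, hfilter,
    card_filter_openPairings hP]
  congr 2
  grind

theorem coverCount_insert_pair_self (hL : ∀ l ∈ L, l < T) (hR : ∀ t ∈ R, T < t) (ha : a ∈ L)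
    (hP : P ∈ openPairings (L.erase a) R) :
    coverCount (insert {a, T} P) {a, T} = (L.filter (· < a)).card := by
  classical
  have haT := hL a ha
  have hself : ¬ Covers ({a, T} : Finset (Fin n)) {a, T} := by
    simp [covers_pair_iff haT haT]
  have hfilter : P.filter (fun V => Covers V {a, T}) =
      P.filter fun V => ∃ l ∈ V, l ∈ L.erase a ∧ l < a := by
    refine Finset.filter_congr fun V hV => ?_
    obtain ⟨c, b, hcb, hTb, rfl, hc⟩ := exists_eq_pair_of_mem_openPairings
      (fun l hl => hL l (Finset.mem_of_mem_erase hl)) hR hP hV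
    rw [covers_pair_iff hcb haT]
    simp only [Finset.mem_insert, Finset.mem_singleton, exists_eq_or_imp, exists_eq_left, hc]
    grind
  rw [coverCount, Finset.filter_insert, if_neg hself, hfilter, card_filter_openPairings hP]
  congr 1
  grind

theorem coverCount_insert_pair_of_mem (hL : ∀ l ∈ L, l < T) (hR : ∀ t ∈ R, T < t) (haT : a < T)
    (hP : P ∈ openPairings L R) {V : Finset (Fin n)} (hV : V ∈ P) :
    coverCount (insert {a, T} P) V = coverCount P V := by
  obtain ⟨c, b, hcb, hTb, rfl, -⟩ := exists_eq_pair_of_mem_openPairings hL hR hP hV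
  have hnot : ¬ Covers {a, T} {c, b} := by
    rw [covers_pair_iff haT hcb]
    exact fun h => lt_asymm hTb h.2
  rw [coverCount, Finset.filter_insert, if_neg hnot, coverCount]

/-- The weight `q^{Cr(P)} ∏_{{i,j} ∈ P} c_{Cov({i,j})}(i, j)` of a set of pairs. -/
noncomputable def pairingWeight (q : ℂ) (c : ℕ → Fin n → Fin n → ℂ)
    (P : Finset (Finset (Fin n))) : ℂ :=
  q ^ crossingCount P * ∏ V ∈ P, onPair (c (coverCount P V)) V

theorem pairingWeight_insert_pair (q : ℂ) (c : ℕ → Fin n → Fin n → ℂ) (hL : ∀ l ∈ L, l < T)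
    (hR : ∀ t ∈ R, T < t) (ha : a ∈ L) (hP : P ∈ openPairings (L.erase a) R) :
    pairingWeight q c (insert {a, T} P) =
      q ^ (L.filter (a < ·)).card * c (L.filter (· < a)).card a T * pairingWeight q c P := by
  have hL' : ∀ l ∈ L.erase a, l < T := fun l hl => hL l (Finset.mem_of_mem_erase hl)
  have hB : {a, T} ∉ P := fun h =>
    notMem_of_mem_openPairings (fun hT => lt_irrefl _ (hL' T hT)) (fun hT => lt_irrefl _ (hR T hT))
      hP h (by simp)
  rw [pairingWeight, crossingCount_insert_pair hL hR ha hP hB, Finset.prod_insert hB,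
    coverCount_insert_pair_self hL hR ha hP, onPair_pair _ (hL a ha), pairingWeight, pow_add,
    Finset.prod_congr rfl fun V hV => by
      rw [coverCount_insert_pair_of_mem hL' hR (hL a ha) hP hV]]
  ring

/-- The sum of the weights of all completions of a partial pairing. -/
noncomputable def wickSum (q : ℂ) (c : ℕ → Fin n → Fin n → ℂ) (L R : Finset (Fin n)) : ℂ :=
  ∑ P ∈ openPairings L R, pairingWeight q c P

variable (q : ℂ) (c : ℕ → Fin n → Fin n → ℂ)

theorem wickSum_empty_right (L : Finset (Fin n)) :
    wickSum q c L ∅ = if L = ∅ then 1 else 0 := by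
  have hempty : pairingWeight q c ∅ = 1 := by
    have hpairs : (∅ : Finset (Finset (Fin n))).powersetCard 2 = ∅ := rfl
    simp [pairingWeight, crossingCount, hpairs]
  rw [wickSum, openPairings_empty_right]
  split_ifs <;> simp [hempty]

theorem wickSum_insert_right (hL : ∀ l ∈ L, l < T) (hR : ∀ t ∈ R, T < t) :
    wickSum q c L (insert T R) = wickSum q c (insert T L) R +
      ∑ a ∈ L, q ^ (L.filter (a < ·)).card * c (L.filter (· < a)).card a T *
        wickSum q c (L.erase a) R := by
  have hLR : Disjoint L R :=
    Finset.disjoint_left.2 fun t htL htR => lt_asymm (hL t htL) (hR t htR)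
  simp only [wickSum, Finset.mul_sum]
  rw [sum_openPairings_insert hLR (fun h => lt_irrefl _ (hL T h)) fun h => lt_irrefl _ (hR T h)]
  congr 1
  exact Finset.sum_congr rfl fun a ha => Finset.sum_congr rfl fun P hP =>
    pairingWeight_insert_pair q c hL hR ha hP

end Statistics

end Pairings

/-! ### The Wick formula -/

section Wick

variable {n m : ℕ}

theorem strictMono_snoc {y : Fin m → Fin n} (hy : StrictMono y) {T : Fin n} (hT : ∀ i, y i < T) :
    StrictMono (Fin.snoc y T : Fin (m + 1) → Fin n) := by
  intro i j hij
  induction j using Fin.lastCases with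
  | last =>
    induction i using Fin.lastCases with
    | last => exact absurd hij (lt_irrefl _)
    | cast i => simpa using hT i
  | cast j =>
    induction i using Fin.lastCases with
    | last => exact absurd hij (Fin.le_last _).not_gt
    | cast i => simpa using hy (by simpa using hij)

theorem image_univ_snoc {ι : Type*} [DecidableEq ι] (y : Fin m → ι) (T : ι) :
    Finset.univ.image (Fin.snoc y T : Fin (m + 1) → ι) = insert T (Finset.univ.image y) := by
  rw [← Finset.coe_inj]
  simp [Fin.range_snoc]

theorem image_univ_comp_succAbove {ι : Type*} [DecidableEq ι] {y : Fin (m + 1) → ι}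
    (hy : Function.Injective y) (k : Fin (m + 1)) :
    Finset.univ.image (y ∘ k.succAbove) = (Finset.univ.image y).erase (y k) := by
  rw [← Finset.image_image, Fin.image_succAbove_univ, ← Finset.image_erase hy,
    Finset.erase_eq, Finset.compl_eq_univ_sdiff]

theorem card_filter_image_univ_gt {y : Fin (m + 1) → Fin n} (hy : StrictMono y)
    (k : Fin (m + 1)) : ((Finset.univ.image y).filter (y k < ·)).card = m - (k : ℕ) := by
  rw [Finset.filter_image, Finset.card_image_of_injective _ hy.injective]
  simp only [hy.lt_iff_lt, Finset.filter_lt_eq_Ioi, Fin.card_Ioi]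
  omega

theorem card_filter_image_univ_lt {y : Fin m → Fin n} (hy : StrictMono y) (k : Fin m) :
    ((Finset.univ.image y).filter (· < y k)).card = (k : ℕ) := by
  rw [Finset.filter_image, Finset.card_image_of_injective _ hy.injective]
  simp only [hy.lt_iff_lt, Finset.filter_gt_eq_Iio, Fin.card_Iio]

variable {H : Type*} [NormedAddCommGroup H] [InnerProductSpace ℂ H]
variable (α q : ℝ) (J : H →ₗ[ℂ] H)

/-- The factor `⟨w_j, z_i⟩ + α q^{2d} ⟨w_j, z̄_i⟩` of a pair `{i, j}` covered by `d` pairs. -/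
noncomputable def pairFactor (z w : Fin n → H) (d : ℕ) (i j : Fin n) : ℂ :=
  inner ℂ (w j) (z i) + (α : ℂ) * (q : ℂ) ^ (2 * d) * inner ℂ (w j) (J (z i))

theorem fockInner_ladderOp_word (z w : Fin n → H) {l : List (Fin n)} (hl : l.Pairwise (· < ·))
    {y : Fin m → Fin n} (hy : StrictMono y) (hyl : ∀ i, ∀ t ∈ l, y i < t) :
    fockInner α q J (vacuum H)
        ((l.map fun i => ladderOp α q J (z i) (w i)).reverse.prod (pureTensor (z ∘ y))) =
      wickSum q (pairFactor α q J z w) (Finset.univ.image y) l.toFinset := by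
  induction l generalizing m with
  | nil =>
    have hm : Finset.univ.image y = ∅ ↔ m = 0 := by
      rw [Finset.image_eq_empty, ← Finset.card_eq_zero, Finset.card_fin]
    simp [fockInner_vacuum_pureTensor, wickSum_empty_right, hm]
  | cons T l ih =>
    obtain ⟨hTl, hl⟩ := List.pairwise_cons.1 hl
    have hyT : ∀ i, y i < T := fun i => hyl i T List.mem_cons_self
    have hyl : ∀ i, ∀ t ∈ l, y i < t := fun i t ht => hyl i t (List.mem_cons_of_mem T ht)
    have hopen := ih hl (strictMono_snoc hy hyT) (Fin.lastCases (by simpa using hTl)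
      (by simpa using hyl))
    rw [List.toFinset_cons, wickSum_insert_right _ _ (by simpa using hyT) (by simpa using hTl),
      ← image_univ_snoc, ← hopen, Finset.sum_image hy.injective.injOn, List.map_cons,
      List.reverse_cons, List.prod_append, List.prod_singleton, Module.End.mul_apply, ladderOp,
      LinearMap.add_apply, creation_pureTensor, ← Fin.comp_snoc, fockInner, map_add, map_add,
      LinearMap.add_apply]
    congr 1
    cases m with
    | zero => simp [contractOp_pureTensor_zero]
    | succ m =>
      refine (fockInner_apply_contractOp_pureTensor α q J _ _ _ _).trans
        (Finset.sum_congr rfl fun k _ => ?_)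
      have hclose := ih hl (hy.comp (Fin.strictMono_succAbove k)) fun i => hyl _
      rw [card_filter_image_univ_gt hy, card_filter_image_univ_lt hy,
        ← image_univ_comp_succAbove hy.injective, ← hclose, contraction_apply]
      rfl

theorem fockInner_ladderOp_word_vacuum (z w : Fin n → H) :
    fockInner α q J (vacuum H)
        ((List.ofFn fun i => ladderOp α q J (z i) (w i)).reverse.prod (vacuum H)) =
      wickSum q (pairFactor α q J z w) ∅ Finset.univ := by
  have h := fockInner_ladderOp_word α q J z w (List.pairwise_lt_finRange n)
    (y := Fin.elim0) (fun i => i.elim0) fun i => i.elim0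
  rw [← vacuum_eq_pureTensor, List.toFinset_finRange, ← List.ofFn_eq_map] at h
  simpa using h

end Wick

/-! ### Pair partitions of type B -/

section PairPartitions

variable {n : ℕ}

theorem mem_pairPartitions {π : SetPartition n} : π ∈ pairPartitions n ↔ IsPairPartition π := by
  simp only [pairPartitions, Finset.mem_filter_univ]

theorem mem_pairPartitionsComp {ε : Fin n → Exponent} {π : SetPartition n} :
    π ∈ pairPartitionsComp ε ↔ IsPairPartition π ∧ IsCompatible ε π := by
  simp only [pairPartitionsComp, Finset.mem_filter_univ]

theorem IsPairPartition.isPairing_parts {π : SetPartition n} (hπ : IsPairPartition π) :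
    IsPairing Finset.univ π.parts :=
  ⟨hπ, π.disjoint, π.sup_parts⟩

theorem IsPairing.exists_isPairPartition {P : Finset (Finset (Fin n))}
    (hP : IsPairing Finset.univ P) : ∃ π : SetPartition n, IsPairPartition π ∧ π.parts = P :=
  ⟨⟨P, Finset.supIndep_iff_pairwiseDisjoint.2 hP.2.1, hP.2.2, fun h => by simpa using hP.1 _ h⟩,
    hP.1, rfl⟩

theorem crossingCount_parts (π : SetPartition n) : crossingCount π.parts = Cr π := by
  unfold crossingCount Cr Crosses
  congr!

theorem wickSum_empty_univ (q : ℂ) (c : ℕ → Fin n → Fin n → ℂ) :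
    wickSum q c ∅ Finset.univ = ∑ π ∈ pairPartitions n, pairingWeight q c π.parts := by
  refine (Finset.sum_bij (fun π _ => π.parts) (fun π hπ => ?_) (fun π _ π' _ h => ?_)
    (fun P hP => ?_) fun _ _ => rfl).symm
  · exact mem_openPairings_empty.2 (mem_pairPartitions.1 hπ).isPairing_parts
  · exact Finpartition.ext h
  · obtain ⟨π, hπ, h⟩ := (mem_openPairings_empty.1 hP).exists_isPairPartition
    exact ⟨π, mem_pairPartitions.2 hπ, h⟩

theorem sum_pairPartitionsB {M : Type*} [AddCommMonoid M] (F : SetPartitionB n → M) :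
    ∑ p ∈ pairPartitionsB n, F p = ∑ π ∈ pairPartitions n, ∑ f : π.parts → ℤˣ, F ⟨π, f⟩ := by
  have hsigma : pairPartitionsB n = (pairPartitions n).sigma fun _ => Finset.univ := by
    ext p
    simp [pairPartitionsB, mem_pairPartitions]
  rw [hsigma, Finset.sum_sigma]

theorem sum_pairPartitionsBComp {M : Type*} [AddCommMonoid M] (ε : Fin n → Exponent)
    (F : SetPartitionB n → M) : ∑ p ∈ pairPartitionsBComp ε, F p =
      ∑ π ∈ pairPartitionsComp ε, ∑ f : π.parts → ℤˣ, F ⟨π, f⟩ := by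
  have hsigma : pairPartitionsBComp ε = (pairPartitionsComp ε).sigma fun _ => Finset.univ := by
    ext p
    simp [pairPartitionsBComp, mem_pairPartitionsComp]
  rw [hsigma, Finset.sum_sigma]

theorem onPair_congr {c c' : Fin n → Fin n → ℂ} {V : Finset (Fin n)}
    (h : ∀ i ∈ V, ∀ j ∈ V, i < j → c i j = c' i j) : onPair c V = onPair c' V := by
  refine Finset.prod_congr rfl fun ij hij => ?_
  rw [Finset.mem_filter, Finset.mem_product] at hij
  exact h _ hij.1.1 _ hij.1.2 hij.2

theorem onPair_eq_zero {c : Fin n → Fin n → ℂ} {V : Finset (Fin n)} {i j : Fin n} (hi : i ∈ V)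
    (hj : j ∈ V) (hij : i < j) (h : c i j = 0) : onPair c V = 0 :=
  Finset.prod_eq_zero (i := (i, j))
    (Finset.mem_filter.2 ⟨Finset.mem_product.2 ⟨hi, hj⟩, hij⟩) h

theorem onPair_add_mul (c c' : Fin n → Fin n → ℂ) (r : ℂ) {V : Finset (Fin n)}
    (hV : V.card = 2) :
    onPair (fun i j => c i j + r * c' i j) V = onPair c V + r * onPair c' V := by
  obtain ⟨i, j, hij, rfl⟩ := Finset.card_eq_two.1 hV
  wlog h : i < j generalizing i j
  · rw [Finset.pair_comm]
    exact this j i hij.symm (by rwa [Finset.pair_comm]) (hij.lt_or_gt.resolve_left h)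
  · simp only [onPair_pair _ h]

theorem InNB_eq_sum {p : SetPartitionB n} (hp : IsPairPartition p.1) :
    InNB p = ∑ V : p.1.parts with p.2 V = -1, Cov p.1 V.1 := by
  classical
  rw [InNB, Finset.card_filter, Fintype.sum_prod_type, Finset.sum_filter]
  refine Finset.sum_congr rfl fun V _ => ?_
  rw [Cov, Finset.card_filter,
    ← Finset.sum_coe_sort p.1.parts fun W => if Covers W V.1 then 1 else 0]
  split_ifs with hV <;> simp [hV, hp V.1 V.2]

end PairPartitions

section Weights

variable {H : Type*} [NormedAddCommGroup H] [InnerProductSpace ℂ H]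
variable (α q : ℝ) (J : H →ₗ[ℂ] H) {n : ℕ} (x : Fin n → H)

theorem weightB_eq_prod {p : SetPartitionB n} (hp : IsPairPartition p.1) :
    weightB α q J x p = (q : ℂ) ^ Cr p.1 * ∏ V : p.1.parts,
      if p.2 V = 1 then onPair (fun i j => inner ℂ (x i) (x j)) V.1
      else (α : ℂ) * (q : ℂ) ^ (2 * Cov p.1 V.1) *
        onPair (fun i j => inner ℂ (x i) (J (x j))) V.1 := by
  classical
  have hneg : ∀ V : p.1.parts, ¬ p.2 V = 1 ↔ p.2 V = -1 := fun V =>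
    Int.units_ne_iff_eq_neg
  have hNB : (α : ℂ) ^ NB p = ∏ V : p.1.parts with p.2 V = -1, (α : ℂ) := by
    rw [Finset.prod_const]
    congr!
  have hInNB : (q : ℂ) ^ (2 * InNB p) =
      ∏ V : p.1.parts with p.2 V = -1, (q : ℂ) ^ (2 * Cov p.1 V.1) := by
    rw [Finset.prod_pow_eq_pow_sum, ← Finset.mul_sum, InNB_eq_sum hp]
  simp only [Finset.prod_ite, hneg, Finset.prod_mul_distrib, ← hNB, ← hInNB, weightB, pow_add]
  ring

theorem sum_weightB {π : SetPartition n} (hπ : IsPairPartition π) :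
    ∑ f : π.parts → ℤˣ, weightB α q J x ⟨π, f⟩ = weight α q J x π := by
  classical
  set a : π.parts → ℤˣ → ℂ := fun V s =>
    if s = 1 then onPair (fun i j => inner ℂ (x i) (x j)) V.1
    else (α : ℂ) * (q : ℂ) ^ (2 * Cov π V.1) *
      onPair (fun i j => inner ℂ (x i) (J (x j))) V.1 with ha
  calc ∑ f : π.parts → ℤˣ, weightB α q J x ⟨π, f⟩
      = ∑ f : π.parts → ℤˣ, (q : ℂ) ^ Cr π * ∏ V, a V (f V) :=
        Finset.sum_congr rfl fun f _ => weightB_eq_prod α q J x (p := ⟨π, f⟩) hπ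
    _ = (q : ℂ) ^ Cr π * ∏ V, ∑ s, a V s := by
        rw [← Finset.mul_sum, Fintype.prod_sum]
    _ = weight α q J x π := by
        rw [weight, ← Finset.prod_coe_sort π.parts]
        congr 1
        refine Finset.prod_congr rfl fun V _ => ?_
        rw [onPair_add_mul _ _ _ (hπ V.1 V.2), UnitsInt.univ, Finset.sum_pair (by decide)]
        simp [ha]

theorem sum_weightB_pairPartitionsB :
    ∑ p ∈ pairPartitionsB n, weightB α q J x p = ∑ π ∈ pairPartitions n, weight α q J x π := by
  rw [sum_pairPartitionsB]
  exact Finset.sum_congr rfl fun π hπ => sum_weightB α q J x (mem_pairPartitions.1 hπ)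

theorem sum_weightB_pairPartitionsBComp (ε : Fin n → Exponent) :
    ∑ p ∈ pairPartitionsBComp ε, weightB α q J x p =
      ∑ π ∈ pairPartitionsComp ε, weight α q J x π := by
  rw [sum_pairPartitionsBComp]
  exact Finset.sum_congr rfl fun π hπ => sum_weightB α q J x (mem_pairPartitionsComp.1 hπ).1

theorem pairingWeight_created_annihilated (ε : Fin n → Exponent) (π : SetPartition n)
    [Decidable (IsCompatible ε π)] :
    pairingWeight q (pairFactor α q J (fun i => (ε i).created (x i))
        fun i => (ε i).annihilated (x i)) π.parts =
      if IsCompatible ε π then pairingWeight q (pairFactor α q J x x) π.parts else 0 := by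
  split_ifs with hπ
  · refine congrArg _ (Finset.prod_congr rfl fun V hV => onPair_congr fun i hi j hj hij => ?_)
    obtain ⟨hεi, hεj⟩ := hπ V hV i hi j hj hij
    simp only [pairFactor, hεi, hεj, Exponent.created, Exponent.annihilated]
  · simp only [IsCompatible, not_forall] at hπ
    obtain ⟨V, hV, i, hi, j, hj, hij, hε⟩ := hπ
    rw [pairingWeight, Finset.prod_eq_zero hV, mul_zero]
    refine onPair_eq_zero hi hj hij ?_
    rw [pairFactor]
    cases hεi : ε i <;> cases hεj : ε j <;>
      simp_all [Exponent.created, Exponent.annihilated]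

variable {J x}

theorem pairingWeight_eq_weight (hre : ∀ i j, inner ℂ (x i) (x j) = inner ℂ (x j) (x i))
    (hbar : ∀ i j, inner ℂ (x i) (J (x j)) = inner ℂ (x j) (J (x i))) (π : SetPartition n) :
    pairingWeight q (pairFactor α q J x x) π.parts = weight α q J x π := by
  have hfactor : pairFactor α q J x x = fun d i j => inner ℂ (x i) (x j) +
      (α : ℂ) * (q : ℂ) ^ (2 * d) * inner ℂ (x i) (J (x j)) := by
    funext d i j
    rw [pairFactor, hre j i, hbar j i]
  rw [hfactor, pairingWeight, weight, crossingCount_parts]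
  rfl

theorem conj_weight (hJ : J.IsSymmetric) (hre : ∀ i j, inner ℂ (x i) (x j) = inner ℂ (x j) (x i))
    (hbar : ∀ i j, inner ℂ (x i) (J (x j)) = inner ℂ (x j) (J (x i))) (π : SetPartition n) :
    starRingEnd ℂ (weight α q J x π) = weight α q J x π := by
  have hbar' : ∀ i j, inner ℂ (J (x j)) (x i) = inner ℂ (x i) (J (x j)) := fun i j => by
    rw [hJ, hbar]
  simp only [weight, onPair, map_mul, map_pow, map_prod, map_add, Complex.conj_ofReal,
    inner_conj_symm, hbar', fun i j => hre j i]

theorem fockInner_bOp_word (hJ : J.IsSymmetric)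
    (hre : ∀ i j, inner ℂ (x i) (x j) = inner ℂ (x j) (x i))
    (hbar : ∀ i j, inner ℂ (x i) (J (x j)) = inner ℂ (x j) (J (x i))) (ε : Fin n → Exponent) :
    fockInner α q J (vacuum H)
        ((List.ofFn fun i => bOp α q J (ε i) (x i)).reverse.prod (vacuum H)) =
      ∑ π ∈ pairPartitionsComp ε, weight α q J x π := by
  classical
  have hcomp : pairPartitionsComp ε = (pairPartitions n).filter (IsCompatible ε) := by
    ext π
    simp [mem_pairPartitionsComp, mem_pairPartitions]
  rw [fockInner_prod_eq_of_isAdjointPair (fun i => isAdjointPair_bOp hJ (ε i) (x i))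
    fun i => isAdjointPair_ladderOp_bOp hJ (ε i) (x i), fockInner_ladderOp_word_vacuum,
    wickSum_empty_univ, hcomp, Finset.sum_filter]
  refine Finset.sum_congr rfl fun π _ => ?_
  rw [pairingWeight_created_annihilated, pairingWeight_eq_weight α q hre hbar]

theorem fockInner_gaussian_word_reverse (hJ : J.IsSymmetric)
    (hre : ∀ i j, inner ℂ (x i) (x j) = inner ℂ (x j) (x i))
    (hbar : ∀ i j, inner ℂ (x i) (J (x j)) = inner ℂ (x j) (J (x i))) :
    fockInner α q J (vacuum H)
        ((List.ofFn fun i => gaussian α q J (x i)).reverse.prod (vacuum H)) =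
      ∑ π ∈ pairPartitions n, weight α q J x π := by
  rw [fockInner_prod_eq_of_isAdjointPair (fun i => isAdjointPair_gaussian hJ (x i))
    fun i => isAdjointPair_ladderOp_gaussian hJ (x i), fockInner_ladderOp_word_vacuum,
    wickSum_empty_univ]
  exact Finset.sum_congr rfl fun π _ => pairingWeight_eq_weight α q hre hbar π

theorem fockInner_gaussian_word (hJ : J.IsSymmetric)
    (hre : ∀ i j, inner ℂ (x i) (x j) = inner ℂ (x j) (x i))
    (hbar : ∀ i j, inner ℂ (x i) (J (x j)) = inner ℂ (x j) (J (x i))) :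
    fockInner α q J (vacuum H)
        ((List.ofFn fun i => gaussian α q J (x i)).prod (vacuum H)) =
      ∑ π ∈ pairPartitions n, weight α q J x π := by
  have hself : fockInner α q J (vacuum H)
      ((List.ofFn fun i => gaussian α q J (x i)).prod (vacuum H)) =
      fockInner α q J ((List.ofFn fun i => gaussian α q J (x i)).reverse.prod (vacuum H))
        (vacuum H) := by
    rw [List.ofFn_eq_map]
    exact isAdjointPair_prod (fun i => isAdjointPair_gaussian hJ (x i)) _ _ _
  rw [hself, ← fockInner_conj α q hJ, fockInner_gaussian_word_reverse α q hJ hre hbar, map_sum]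
  exact Finset.sum_congr rfl fun π _ => conj_weight α q hJ hre hbar π

theorem IsComplexificationOf.inner_comm {HR : Submodule ℝ H} (h : IsComplexificationOf HR)
    {y z : H} (hy : y ∈ HR) (hz : z ∈ HR) : inner ℂ y z = inner ℂ z y := by
  rw [← inner_conj_symm, Complex.conj_eq_iff_im]
  exact h.inner_im z hz y hy

end Weights

end TypeBFock

theorem corollary3_general {H : Type*} [NormedAddCommGroup H] [InnerProductSpace ℂ H]
    (J : H →ₗ[ℂ] H) (hJ_symm : J.IsSymmetric) (α q : ℝ) (n : ℕ) (x : Fin n → H)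
    (hx : ∀ i j, inner ℂ (x i) (x j) = inner ℂ (x j) (x i))
    (hx_bar : ∀ i j, inner ℂ (x i) (J (x j)) = inner ℂ (x j) (J (x i))) :
    (∀ ε : Fin n → TypeBFock.Exponent,
      TypeBFock.fockInner α q J (TypeBFock.vacuum H)
          ((List.ofFn (fun i => TypeBFock.bOp α q J (ε i) (x i))).reverse.prod
            (TypeBFock.vacuum H)) =
        ∑ p ∈ TypeBFock.pairPartitionsBComp ε, TypeBFock.weightB α q J x p ∧
      ∑ p ∈ TypeBFock.pairPartitionsBComp ε, TypeBFock.weightB α q J x p =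
        ∑ π ∈ TypeBFock.pairPartitionsComp ε, TypeBFock.weight α q J x π) ∧
    TypeBFock.fockInner α q J (TypeBFock.vacuum H)
        ((List.ofFn (fun i => TypeBFock.gaussian α q J (x i))).reverse.prod
          (TypeBFock.vacuum H)) =
      TypeBFock.fockInner α q J (TypeBFock.vacuum H)
        ((List.ofFn (fun i => TypeBFock.gaussian α q J (x i))).prod (TypeBFock.vacuum H)) ∧
    TypeBFock.fockInner α q J (TypeBFock.vacuum H)
        ((List.ofFn (fun i => TypeBFock.gaussian α q J (x i))).prod (TypeBFock.vacuum H)) =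
      ∑ p ∈ TypeBFock.pairPartitionsB n, TypeBFock.weightB α q J x p ∧
    ∑ p ∈ TypeBFock.pairPartitionsB n, TypeBFock.weightB α q J x p =
      ∑ π ∈ TypeBFock.pairPartitions n, TypeBFock.weight α q J x π := by
  have hG := TypeBFock.fockInner_gaussian_word α q hJ_symm hx hx_bar
  have hsumB := TypeBFock.sum_weightB_pairPartitionsB α q J x
  refine ⟨fun ε => ?_, ?_, hG.trans hsumB.symm, hsumB⟩
  · have hsumB := TypeBFock.sum_weightB_pairPartitionsBComp α q J x ε
    exact ⟨(TypeBFock.fockInner_bOp_word α q hJ_symm hx hx_bar ε).trans hsumB.symm, hsumB⟩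
  · exact (TypeBFock.fockInner_gaussian_word_reverse α q hJ_symm hx hx_bar).trans hG.symm


theorem corollary3 {H : Type*} [NormedAddCommGroup H] [InnerProductSpace ℂ H] [CompleteSpace H]
    [TopologicalSpace.SeparableSpace H]
    (HR : Submodule ℝ H) (hHR : TypeBFock.IsComplexificationOf HR)
    (J : H →ₗ[ℂ] H) (hJ_invol : ∀ x, J (J x) = x) (hJ_symm : J.IsSymmetric)
    (α q : ℝ) (hα : α ∈ Set.Ioo (-1 : ℝ) 1) (hq : q ∈ Set.Ioo (-1 : ℝ) 1)
    (n : ℕ) (x : Fin n → H) (hx : ∀ i, x i ∈ HR)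
    (hx_bar : ∀ i j, inner ℂ (x i) (J (x j)) = inner ℂ (x j) (J (x i))) :
    (∀ ε : Fin n → TypeBFock.Exponent,
      TypeBFock.fockInner α q J (TypeBFock.vacuum H)
          ((List.ofFn (fun i => TypeBFock.bOp α q J (ε i) (x i))).reverse.prod
            (TypeBFock.vacuum H)) =
        ∑ p ∈ TypeBFock.pairPartitionsBComp ε, TypeBFock.weightB α q J x p ∧
      ∑ p ∈ TypeBFock.pairPartitionsBComp ε, TypeBFock.weightB α q J x p =
        ∑ π ∈ TypeBFock.pairPartitionsComp ε, TypeBFock.weight α q J x π) ∧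
    TypeBFock.fockInner α q J (TypeBFock.vacuum H)
        ((List.ofFn (fun i => TypeBFock.gaussian α q J (x i))).reverse.prod
          (TypeBFock.vacuum H)) =
      TypeBFock.fockInner α q J (TypeBFock.vacuum H)
        ((List.ofFn (fun i => TypeBFock.gaussian α q J (x i))).prod (TypeBFock.vacuum H)) ∧
    TypeBFock.fockInner α q J (TypeBFock.vacuum H)
        ((List.ofFn (fun i => TypeBFock.gaussian α q J (x i))).prod (TypeBFock.vacuum H)) =
      ∑ p ∈ TypeBFock.pairPartitionsB n, TypeBFock.weightB α q J x p ∧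
    ∑ p ∈ TypeBFock.pairPartitionsB n, TypeBFock.weightB α q J x p =
      ∑ π ∈ TypeBFock.pairPartitions n, TypeBFock.weight α q J x π := by
  exact corollary3_general J hJ_symm α q n x (fun i j => hHR.inner_comm (hx i) (hx j)) hx_bar
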